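/- **Büchi automata.** Let $C$ be a set of colors. A Büchi automaton $\mathcal M=(Q,\Sigma,\Delta,Q_0,F)$ over $\Sigma=2^{C}$ has a finite set $Q$ of states, $\Delta\subseteq Q\times\Sigma\times Q$ and $Q_0,F\subseteq Q$. For $w\in\Sigma^*$, $(p,w,q,b)\in\Delta^*$ means that some run from $p$ to $q$ reads $w$ and visits $F$ (end points included) iff $b=\mathtt T$. For $w\in\Sigma^\omega$, $(p,w,\mathtt T)\in\Delta^\omega$ means that some run from $p$ reads $w$ and visits some state of $F$ infinitely often. $L(\mathcal M)$ is the set of $w\in\Sigma^\omega$ with $(q_0,w,\mathtt T)\in\Delta^\omega$ for some $q_0\in Q_0$. Finite words $w,w'$ are $\mathcal M$-equivalent if $(p,w,q,b)\in\Delta^*\Leftrightarrow(p,w',q,b)\in\Delta^*$ for all $p,q,b$; infinite words are $\mathcal M$-equivalent if $(p,w,\mathtt T)\in\Delta^\omega\Leftrightarrow(p,w',\mathtt T)\in\Delta^\omega$ for all $p$. Two sets of words are $\mathcal M$-equivalent if each word of either set is $\mathcal M$-equivalent to some word of the other. **Hypergraphs.** A hypergraph $\mathcal H$ has a finite set $V$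 of concrete nodes, abstract nodes $I=\{1,\dots,n\}$, labeled ordinary edges ${\to}\subseteq W\times \mathrm{Act}\times W$ where $W=V\uplus I$, a finite set $E$ of labeled hyperedges, each attached to a finite sequence $\alpha(e)\in W^*$ of nodes, and a coloring $\gamma:V\to 2^{C}$. It is an LTS if $n=0$ and $E=\emptyset$. Hypergraphs are considered up to isomorphism. If $K$ assigns to each $e\in E$ a hypergraph $K(e)$ with $|\alpha(e)|$ abstract nodes, then $\mathcal H[K]$ is obtained by replacing each $e$ by a copy of $K(e)$, whose $i$-th abstract node is identified with the $i$-th node attached to $e$; the edge relations are united. If $\mathcal H$ has exactly one hyperedge, $\mathcal H[\mathcal K]$ denotes its replacement by $\mathcal K$. The handle $A^\bullet$ of a label $A$ of arity $k$ has no concrete nodes, $k$ abstract nodes and one hyperedge labeled $A$ attached to $1\cdots k$. $\mathrm{Traces}^*(u,v)$ is the set of color words of finite paths with at least one edge from $u$ to $v$ all of whose inner nodes are concrete, and $\mathrm{Traces}^\omega(u)$ the set of color words of infinite paths from $u$ all of whose later nodes are concrete (abstract end points contribute no letter). $(\mathcal H,u)\models\mathcal M$ means $\mathrm{Traces}^\omega(u)\subseteq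 L(\mathcal M)$. **Views.** Let $UA_{\mathcal H}$ be the set of concrete nodes of $\mathcal H$ that are attached to no hyperedge. A view is a pair $(\mathcal H,U)$ with $U\subseteq UA_{\mathcal H}$; its exposed nodes are the nodes in $U$, the attached nodes and the abstract nodes. Replacement of hyperedges of views unites the sets $U$, and $(\mathcal H,U),x\models\mathcal M$ means $(\mathcal H,x)\models\mathcal M$. Two views are $\mathcal M$-equivalent if they have the same number of abstract nodes and there are a bijection $\eta$ between their sets $U$, a bijection $\mu$ between their sets of hyperedges preserving the number of attached nodes, and a bijection $\nu$ between their exposed nodes that extends $\eta$, maps the $i$-th abstract node to the $i$-th abstract node and the $i$-th node attached to $e$ to the $i$-th node attached to $\mu(e)$, such that for all exposed $x,y$: 1. $\mathrm{Traces}^*(x,y)$ and $\mathrm{Traces}^*(\nu(x),\nu(y))$ are $\mathcal M$-equivalent; 2. $\mathrm{Traces}^\omega(x)$ and $\mathrm{Traces}^\omega(\nu(x))$ are $\mathcal M$-equivalent; 3. if $x$ is concrete, the one-letter words $\gamma(x)$ and $\gamma(\nu(x))$ are $\mathcal M$-equivalent. $[\mathcal V]$ is the $\mathcal M$-equivalence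 class of $\mathcal V$. Replacement is applied to classes through representatives. **Grammars.** A hyperedge replacement grammar (HRG) $\mathcal G=(N,P,Z)$ has a finite set $N$ of nonterminals with arities, start symbols $Z\subseteq N$ and a set $P$ of rules $(A,\mathcal R)$, where $A\in N$, the hypergraph $\mathcal R$ has as many abstract nodes as the arity of $A$, and each hyperedge of $\mathcal R$ is labeled by a nonterminal whose arity is its number of attached nodes. A derivation tree of $A$ is either the leaf $A$, or a rule $(A,\mathcal R)$ with a derivation tree of $\ell(e)$ for every hyperedge $e$ of $\mathcal R$ labeled $\ell(e)$. It denotes a hypergraph: a leaf $A$ denotes $A^\bullet$, and an inner tree denotes $\mathcal R$ with each $e$ replaced by the hypergraph of its subtree. $\mathcal L_A(\mathcal G)$ is the set of hypergraphs of trees of $A$ without leaves of the first kind, and $\mathcal L(\mathcal G)=\bigcup_{A\in Z}\mathcal L_A(\mathcal G)$. $\mathcal C_B(\mathcal G)$ is the set of hypergraphs of trees of start symbols with exactly one leaf of the first kind, that leaf being $B$. **Refinement and recoloring.** The refined grammar $\mathcal G_{\equiv\mathcal M}$ has as nonterminals the triples $(A,\mathfrak S,\mathfrak C)$ with $A\in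 N$, $\mathfrak S=[(\mathcal H,\emptyset)]$ for some $\mathcal H\in\mathcal L_A(\mathcal G)$ and $\mathfrak C=[(\mathcal J,\emptyset)]$ for some $\mathcal J\in\mathcal C_A(\mathcal G)$; such a triple has the arity of $A$, and is a start symbol iff $A\in Z$ and $\mathfrak C=[(A^\bullet,\emptyset)]$. Its rules are all $((A,\mathfrak S,\mathfrak C),\mathcal R)$ over these nonterminals, with $\mathcal R$ labeled by triples $(B(e),\mathfrak T(e),\mathfrak D(e))$, such that relabeling $\mathcal R$ by $B$ gives a rule of $\mathcal G$ for $A$, $\mathfrak S=(\mathcal R,\emptyset)[\mathfrak T]$, and $\mathfrak D(e)=\mathfrak C[(\mathcal R,\emptyset)[\mathfrak T\langle e/B(e)^\bullet\rangle]]$ for every hyperedge $e$ of $\mathcal R$, where $\mathfrak T\langle e/B(e)^\bullet\rangle$ agrees with $\mathfrak T$ except that it assigns the handle $B(e)^\bullet$ to $e$. The recolored grammar $\mathcal G_{\mathcal M}$ uses the colors $C\uplus\{\mathcal M\}$ and has the same nonterminals and start symbols. Its rules are obtained from the rules $((A,\mathfrak S,\mathfrak C),\mathcal R)$ of $\mathcal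 G_{\equiv\mathcal M}$ by adding the color $\mathcal M$ to exactly those concrete nodes $v$ of $\mathcal R$ with $(\mathfrak C[(\mathcal R,UA_{\mathcal R})[\mathfrak T]],v)\models\mathcal M$, that is, $(\mathcal J[\mathcal R[K]],v)\models\mathcal M$ for representatives $(\mathcal J,\emptyset)$ of $\mathfrak C$ and $(K(e),\emptyset)$ of $\mathfrak T(e)$. In $(\mathcal H,v)\models\mathcal M$ for a hypergraph $\mathcal H$ with colors $C\uplus\{\mathcal M\}$, the color $\mathcal M$ is ignored. **Theorem (Soundness and Completeness).** For every HRG $\mathcal G$ with colors $C$ and every Büchi automaton $\mathcal M$ over $2^{C}$, $$\forall \mathcal H\in\mathcal L(\mathcal G_{\mathcal M})\ \ \forall v\in V_{\mathcal H}:\qquad \mathcal M\in\gamma_{\mathcal H}(v)\iff(\mathcal H,v)\models\mathcal M .$$ -/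

import Mathlib

open Set

universe uC uA uL uQ

/-! ### Büchi automata -/

/-- Büchi automata with states in `Q` and alphabet `S`. Finiteness of `Q` is an instance
argument wherever it is needed. -/
structure BuchiAutomaton (Q : Type uQ) (S : Type uC) where
  Δ : Set (Q × S × Q)
  init : Set Q
  final : Set Q

namespace BuchiAutomaton

variable {Q : Type uQ} {S : Type uC} (M : BuchiAutomaton Q S)

/-- `(p, w, q, b) ∈ Δ*`: some finite run `r 0, …, r w.length` reads `w`, leads from `p` to `q`,
and `b` says whether it visits a final state. -/
def DeltaStar (p : Q) (w : List S) (q : Q) (b : Bool) : Prop :=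
  ∃ r : ℕ → Q, r 0 = p ∧ r w.length = q ∧
    (∀ (i : ℕ) (h : i < w.length), (r i, w[i], r (i + 1)) ∈ M.Δ) ∧
    (b = true ↔ ∃ i, i ≤ w.length ∧ r i ∈ M.final)

/-- `(p, w, b) ∈ Δ^ω`: some infinite run from `p` reads `w`, and `b` says whether some final state
appears infinitely often in it. -/
def DeltaOmega (p : Q) (w : ℕ → S) (b : Bool) : Prop :=
  ∃ r : ℕ → Q, r 0 = p ∧ (∀ i, (r i, w i, r (i + 1)) ∈ M.Δ) ∧
    (b = true ↔ ∃ f ∈ M.final, {i | r i = f}.Infinite)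

/-- The accepted infinite words. -/
def language : Set (ℕ → S) :=
  {w | ∃ q ∈ M.init, M.DeltaOmega q w true}

/-- `M`-equivalence of finite words. -/
def WordEquiv (w w' : List S) : Prop :=
  ∀ p q b, M.DeltaStar p w q b ↔ M.DeltaStar p w' q b

/-- `M`-equivalence of infinite words. -/
def OmegaEquiv (w w' : ℕ → S) : Prop :=
  ∀ p, M.DeltaOmega p w true ↔ M.DeltaOmega p w' true

end BuchiAutomaton

/-- Lifting of a relation on words to sets of words. -/
def SetEquiv {α : Type*} (r : α → α → Prop) (A B : Set α) : Prop :=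
  (∀ a ∈ A, ∃ b ∈ B, r a b) ∧ (∀ b ∈ B, ∃ a ∈ A, r a b)

/-- The infinite word obtained by writing the finite word `l` in front of `s`. -/
def prependWord {α : Type*} (l : List α) (s : ℕ → α) : ℕ → α :=
  fun i => if h : i < l.length then l[i] else s (i - l.length)

/-! ### Hypergraphs -/

/-- Hypergraphs with node colors `C`, actions `Act` and hyperedge labels `L`. The nodes are
`V ⊕ Fin n`: concrete nodes, and the abstract nodes `1, …, n` (numbered from `0` here).
Hyperedge `e` is attached to the sequence of nodes `att e` of length `rank e`. -/
structure HG (C : Type uC) (Act : Type uA) (L : Type uL) where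
  V : Type
  finV : Finite V
  n : ℕ
  edge : Set ((V ⊕ Fin n) × Act × (V ⊕ Fin n))
  E : Type
  finE : Finite E
  rank : E → ℕ
  att : (e : E) → Fin (rank e) → V ⊕ Fin n
  color : V → Set C
  lab : E → L

namespace HG

variable {C : Type uC} {Act : Type uA} {L : Type uL}

/-- All nodes. -/
abbrev W (H : HG C Act L) : Type := H.V ⊕ Fin H.n

/-- There is an ordinary edge from `x` to `y`. -/
def Step (H : HG C Act L) (x y : H.W) : Prop := ∃ a, (x, a, y) ∈ H.edge

/-- The colors of a one-node sequence after abstract nodes are filtered out. -/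
def nodeWord (H : HG C Act L) : H.W → List (Set C)
  | Sum.inl v => [H.color v]
  | Sum.inr _ => []

/-- Finite traces from `u` to `v`: paths `u p v` all of whose inner nodes `p` are concrete. -/
def finTraces (H : HG C Act L) (u v : H.W) : Set (List (Set C)) :=
  {w | ∃ p : List H.V, List.IsChain H.Step (u :: (p.map Sum.inl ++ [v])) ∧
    w = H.nodeWord u ++ p.map H.color ++ H.nodeWord v}

/-- Infinite traces from `u`: infinite paths `u p` with all nodes of `p` concrete. -/
def infTraces (H : HG C Act L) (u : H.W) : Set (ℕ → Set C) :=
  {w | ∃ p : ℕ → H.V, H.Step u (Sum.inl (p 0)) ∧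
    (∀ i, H.Step (Sum.inl (p i)) (Sum.inl (p (i + 1)))) ∧
    w = prependWord (H.nodeWord u) (fun i => H.color (p i))}

/-- `(H, u) ⊨ M`: every infinite trace from `u` is accepted by `M`. -/
def Sat {Q : Type uQ} (M : BuchiAutomaton Q (Set C)) (H : HG C Act L) (u : H.W) : Prop :=
  H.infTraces u ⊆ M.language

/-- Hypergraphs that differ only in names of nodes and hyperedges. -/
structure Iso (H H' : HG C Act L) where
  onV : H.V ≃ H'.V
  onE : H.E ≃ H'.E
  n_eq : H.n = H'.n
  edge_iff : ∀ x a y, (x, a, y) ∈ H.edge ↔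
    (Sum.map onV (Fin.cast n_eq) x, a, Sum.map onV (Fin.cast n_eq) y) ∈ H'.edge
  rank_eq : ∀ e, H.rank e = H'.rank (onE e)
  att_eq : ∀ e i, Sum.map onV (Fin.cast n_eq) (H.att e i) =
    H'.att (onE e) (Fin.cast (rank_eq e) i)
  color_eq : ∀ v, H.color v = H'.color (onV v)
  lab_eq : ∀ e, H.lab e = H'.lab (onE e)

/-- Change of hyperedge labels along `f`. -/
def mapLab {L' : Type*} (f : L → L') (H : HG C Act L) : HG C Act L' where
  V := H.V
  finV := H.finV
  n := H.n
  edge := H.edge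
  E := H.E
  finE := H.finE
  rank := H.rank
  att := H.att
  color := H.color
  lab e := f (H.lab e)

/-- In `Option C`, the colors `C` are extended by one new color `none`. This deletes the new
color from all nodes. -/
def del (H : HG (Option C) Act L) : HG C Act L where
  V := H.V
  finV := H.finV
  n := H.n
  edge := H.edge
  E := H.E
  finE := H.finE
  rank := H.rank
  att := H.att
  color v := {c | some c ∈ H.color v}
  lab := H.lab

/-- The `k`-handle labeled `A`. -/
def handle (A : L) (k : ℕ) : HG C Act L where
  V := Empty
  finV := inferInstance
  n := k
  edge := ∅
  E := Unit
  finE := inferInstance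
  rank _ := k
  att _ i := Sum.inr i
  color v := v.elim
  lab _ := A

/-- The nodes of `H` inside the hypergraph obtained by replacing its hyperedges by `K`. -/
def outer (H : HG C Act L) (K : H.E → HG C Act L) :
    H.W → (H.V ⊕ (Σ e : H.E, (K e).V)) ⊕ Fin H.n
  | Sum.inl v => Sum.inl (Sum.inl v)
  | Sum.inr i => Sum.inr i

/-- The map `f_e`: concrete nodes of `K e` are kept, and the `i`-th abstract node of `K e` is
identified with the `i`-th node attached to `e`. -/
def inner (H : HG C Act L) (K : H.E → HG C Act L) (hK : ∀ e, (K e).n = H.rank e) (e : H.E) :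
    (K e).W → (H.V ⊕ (Σ e : H.E, (K e).V)) ⊕ Fin H.n
  | Sum.inl v => Sum.inl (Sum.inr ⟨e, v⟩)
  | Sum.inr i => H.outer K (H.att e (Fin.cast (hK e) i))

/-- Hyperedge replacement. -/
def repl (H : HG C Act L) (K : H.E → HG C Act L) (hK : ∀ e, (K e).n = H.rank e) :
    HG C Act L where
  V := H.V ⊕ (Σ e : H.E, (K e).V)
  finV := by
    have := H.finV
    have := H.finE
    have := fun e => (K e).finV
    infer_instance
  n := H.n
  edge := {t | (∃ x a y, (x, a, y) ∈ H.edge ∧ t = (H.outer K x, a, H.outer K y)) ∨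
    ∃ e x a y, (x, a, y) ∈ (K e).edge ∧ t = (H.inner K hK e x, a, H.inner K hK e y)}
  E := Σ e : H.E, (K e).E
  finE := by
    have := H.finE
    have := fun e => (K e).finE
    infer_instance
  rank d := (K d.1).rank d.2
  att d i := H.inner K hK d.1 ((K d.1).att d.2 i)
  color
    | Sum.inl v => H.color v
    | Sum.inr d => (K d.1).color d.2
  lab d := (K d.1).lab d.2

/-- The unattached concrete nodes. -/
def UA (H : HG C Act L) : Set H.V := {v | ∀ e i, H.att e i ≠ Sum.inl v}

end HG

/-! ### Hypergraphs with a view -/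

/-- A hypergraph together with a set of unattached nodes. -/
structure HGV (C : Type uC) (Act : Type uA) (L : Type uL) where
  H : HG C Act L
  U : Set H.V
  unattached : U ⊆ H.UA

namespace HGV

variable {C : Type uC} {Act : Type uA} {L : Type uL}

/-- The exposed nodes: those in the view, attached nodes and abstract nodes. -/
def X (𝓥 : HGV C Act L) : Set 𝓥.H.W :=
  {x | ∀ v, x = Sum.inl v → v ∈ 𝓥.U ∨ v ∉ 𝓥.H.UA}

/-- The view `(H, ∅)`. -/
def trivial (H : HG C Act L) : HGV C Act L := ⟨H, ∅, empty_subset _⟩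

/-- The view that exposes all unattached nodes. -/
def full (H : HG C Act L) : HGV C Act L := ⟨H, H.UA, Subset.rfl⟩

theorem abs_mem_X (𝓥 : HGV C Act L) (i : Fin 𝓥.H.n) : (Sum.inr i : 𝓥.H.W) ∈ 𝓥.X := by
  intro v h
  simp at h

theorem view_mem_X (𝓥 : HGV C Act L) (v : 𝓥.U) : (Sum.inl v.1 : 𝓥.H.W) ∈ 𝓥.X := by
  intro w h
  obtain rfl : v.1 = w := by simpa using h
  exact Or.inl v.2

theorem att_mem_X (𝓥 : HGV C Act L) (e : 𝓥.H.E) (i : Fin (𝓥.H.rank e)) :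
    𝓥.H.att e i ∈ 𝓥.X :=
  fun _ h => Or.inr fun h' => h' e i h

/-- Hyperedge replacement on views joins the views. -/
def repl (𝓥 : HGV C Act L) (K : 𝓥.H.E → HGV C Act L)
    (hK : ∀ e, (K e).H.n = 𝓥.H.rank e) : HGV C Act L where
  H := 𝓥.H.repl (fun e => (K e).H) hK
  U := {x | (∃ v ∈ 𝓥.U, x = Sum.inl v) ∨ ∃ e, ∃ v ∈ (K e).U, x = Sum.inr ⟨e, v⟩}
  unattached := by
    rintro x hx ⟨e, d⟩ i h
    change HG.inner 𝓥.H (fun e => (K e).H) hK e ((K e).H.att d i) = Sum.inl x at h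
    rcases hy : (K e).H.att d i with v | j
    · rw [hy] at h
      obtain rfl : Sum.inr ⟨e, v⟩ = x := Sum.inl.inj h
      rcases hx with ⟨v', _, h'⟩ | ⟨e', v', hv', h'⟩
      · simp at h'
      · obtain ⟨rfl, h''⟩ := Sigma.mk.inj (Sum.inr.inj h')
        obtain rfl := eq_of_heq h''
        exact (K e).unattached hv' d i hy
    · rw [hy] at h
      simp only [HG.inner] at h
      rcases hz : 𝓥.H.att e (Fin.cast (hK e) j) with v | k
      · rw [hz] at h
        obtain rfl : Sum.inl v = x := Sum.inl.inj h
        rcases hx with ⟨v', hv', h'⟩ | ⟨e', v', _, h'⟩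
        · obtain rfl : v = v' := Sum.inl.inj h'
          exact 𝓥.unattached hv' e _ hz
        · simp at h'
      · rw [hz] at h
        simp [HG.outer] at h

/-- A coupling `(η, μ)` of two views, together with the induced bijection `ν` of exposed nodes. -/
structure Coupling (𝓥 𝓥' : HGV C Act L) where
  η : 𝓥.U ≃ 𝓥'.U
  μ : 𝓥.H.E ≃ 𝓥'.H.E
  ν : 𝓥.X ≃ 𝓥'.X
  n_eq : 𝓥.H.n = 𝓥'.H.n
  rank_eq : ∀ e, 𝓥.H.rank e = 𝓥'.H.rank (μ e)
  ν_abs : ∀ i, (ν ⟨Sum.inr i, 𝓥.abs_mem_X i⟩).1 = Sum.inr (Fin.cast n_eq i)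
  ν_view : ∀ v, (ν ⟨Sum.inl v.1, 𝓥.view_mem_X v⟩).1 = Sum.inl (η v).1
  ν_att : ∀ e i, (ν ⟨𝓥.H.att e i, 𝓥.att_mem_X e i⟩).1 =
    𝓥'.H.att (μ e) (Fin.cast (rank_eq e) i)

end HGV

namespace BuchiAutomaton

variable {Q : Type uQ} {C : Type uC} {Act : Type uA} {L : Type uL}

/-- `M`-equivalence of views under a coupling: `M` can distinguish neither the colors of coupled
exposed nodes, nor the finite traces between them, nor the infinite traces from them. -/
def MEquivVia (M : BuchiAutomaton Q (Set C)) {𝓥 𝓥' : HGV C Act L}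
    (κ : HGV.Coupling 𝓥 𝓥') : Prop :=
  (∀ x, M.WordEquiv (𝓥.H.nodeWord x.1) (𝓥'.H.nodeWord (κ.ν x).1)) ∧
  (∀ x y, SetEquiv M.WordEquiv (𝓥.H.finTraces x.1 y.1)
    (𝓥'.H.finTraces (κ.ν x).1 (κ.ν y).1)) ∧
  (∀ x, SetEquiv M.OmegaEquiv (𝓥.H.infTraces x.1) (𝓥'.H.infTraces (κ.ν x).1))

/-- `M`-equivalence of views. -/
def MEquiv (M : BuchiAutomaton Q (Set C)) (𝓥 𝓥' : HGV C Act L) : Prop :=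
  ∃ κ : HGV.Coupling 𝓥 𝓥', M.MEquivVia κ

/-- The `M`-equivalence class of a view. -/
def cls (M : BuchiAutomaton Q (Set C)) (𝓥 : HGV C Act L) : Set (HGV C Act L) :=
  {𝓥' | M.MEquiv 𝓥 𝓥'}

end BuchiAutomaton

/-! `M`-equivalence is an equivalence relation with finitely many classes of each shape; this is
used to see that refined grammars have finitely many nonterminals. -/

namespace HGV.Coupling

variable {C : Type uC} {Act : Type uA} {L : Type uL}

def refl (𝓥 : HGV C Act L) : Coupling 𝓥 𝓥 where
  η := Equiv.refl _
  μ := Equiv.refl _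
  ν := Equiv.refl _
  n_eq := rfl
  rank_eq _ := rfl
  ν_abs _ := rfl
  ν_view _ := rfl
  ν_att _ _ := rfl

theorem att_congr (𝓥 : HGV C Act L) {e e' : 𝓥.H.E} (h : e = e') (i : Fin (𝓥.H.rank e))
    (j : Fin (𝓥.H.rank e')) (hij : i.val = j.val) : 𝓥.H.att e i = 𝓥.H.att e' j := by
  subst h
  rw [Fin.ext hij]

def symm {𝓥 𝓥' : HGV C Act L} (κ : Coupling 𝓥 𝓥') : Coupling 𝓥' 𝓥 where
  η := κ.η.symm
  μ := κ.μ.symm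
  ν := κ.ν.symm
  n_eq := κ.n_eq.symm
  rank_eq e := by rw [κ.rank_eq, Equiv.apply_symm_apply]
  ν_abs i := by
    have h : κ.ν ⟨Sum.inr (Fin.cast κ.n_eq.symm i), 𝓥.abs_mem_X _⟩ =
        ⟨Sum.inr i, 𝓥'.abs_mem_X i⟩ := Subtype.ext (κ.ν_abs _)
    rw [← h, Equiv.symm_apply_apply]
  ν_view v := by
    have h : κ.ν ⟨Sum.inl (κ.η.symm v).1, 𝓥.view_mem_X _⟩ =
        ⟨Sum.inl v.1, 𝓥'.view_mem_X v⟩ := Subtype.ext (by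
      rw [κ.ν_view, Equiv.apply_symm_apply])
    rw [← h, Equiv.symm_apply_apply]
  ν_att e i := by
    have hr : 𝓥'.H.rank e = 𝓥.H.rank (κ.μ.symm e) := by
      rw [κ.rank_eq, Equiv.apply_symm_apply]
    have h : κ.ν ⟨𝓥.H.att (κ.μ.symm e) (Fin.cast hr i), 𝓥.att_mem_X _ _⟩ =
        ⟨𝓥'.H.att e i, 𝓥'.att_mem_X e i⟩ := Subtype.ext (by
      rw [κ.ν_att]
      exact att_congr 𝓥' (by simp) _ _ rfl)
    rw [← h, Equiv.symm_apply_apply]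

def trans {𝓥 𝓥' 𝓥'' : HGV C Act L} (κ : Coupling 𝓥 𝓥') (κ' : Coupling 𝓥' 𝓥'') :
    Coupling 𝓥 𝓥'' where
  η := κ.η.trans κ'.η
  μ := κ.μ.trans κ'.μ
  ν := κ.ν.trans κ'.ν
  n_eq := κ.n_eq.trans κ'.n_eq
  rank_eq e := (κ.rank_eq e).trans (κ'.rank_eq _)
  ν_abs i := by
    have h : κ.ν ⟨Sum.inr i, 𝓥.abs_mem_X i⟩ =
        ⟨Sum.inr (Fin.cast κ.n_eq i), 𝓥'.abs_mem_X _⟩ := Subtype.ext (κ.ν_abs _)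
    rw [Equiv.trans_apply, h, κ'.ν_abs]
    rfl
  ν_view v := by
    have h : κ.ν ⟨Sum.inl v.1, 𝓥.view_mem_X v⟩ =
        ⟨Sum.inl (κ.η v).1, 𝓥'.view_mem_X _⟩ := Subtype.ext (κ.ν_view _)
    rw [Equiv.trans_apply, h, κ'.ν_view]
    rfl
  ν_att e i := by
    have h : κ.ν ⟨𝓥.H.att e i, 𝓥.att_mem_X e i⟩ =
        ⟨𝓥'.H.att (κ.μ e) (Fin.cast (κ.rank_eq e) i), 𝓥'.att_mem_X _ _⟩ :=
      Subtype.ext (κ.ν_att _ _)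
    rw [Equiv.trans_apply, h, κ'.ν_att]
    rfl

end HGV.Coupling

theorem SetEquiv.symm {α : Type*} {r : α → α → Prop} (hr : ∀ a b, r a b → r b a) {A B : Set α}
    (h : SetEquiv r A B) : SetEquiv r B A :=
  ⟨fun b hb => (h.2 b hb).imp fun _ ha => ⟨ha.1, hr _ _ ha.2⟩,
    fun a ha => (h.1 a ha).imp fun _ hb => ⟨hb.1, hr _ _ hb.2⟩⟩

theorem SetEquiv.trans {α : Type*} {r : α → α → Prop}
    (hr : ∀ a b c, r a b → r b c → r a c) {A B D : Set α}
    (h : SetEquiv r A B) (h' : SetEquiv r B D) : SetEquiv r A D := by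
  constructor
  · intro a ha
    obtain ⟨b, hb, hab⟩ := h.1 a ha
    obtain ⟨d, hd, hbd⟩ := h'.1 b hb
    exact ⟨d, hd, hr _ _ _ hab hbd⟩
  · intro d hd
    obtain ⟨b, hb, hbd⟩ := h'.2 d hd
    obtain ⟨a, ha, hab⟩ := h.2 b hb
    exact ⟨a, ha, hr _ _ _ hab hbd⟩

theorem SetEquiv.of_image {α β : Type*} {r : α → α → Prop} (f : α → β)
    (hf : ∀ a b, f a = f b → r a b) {A B : Set α} (h : f '' A = f '' B) : SetEquiv r A B := by
  constructor
  · intro a ha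
    obtain ⟨b, hb, e⟩ : f a ∈ f '' B := h ▸ mem_image_of_mem f ha
    exact ⟨b, hb, hf _ _ e.symm⟩
  · intro b hb
    obtain ⟨a, ha, e⟩ : f b ∈ f '' A := h ▸ mem_image_of_mem f hb
    exact ⟨a, ha, hf _ _ e⟩

namespace BuchiAutomaton

variable {Q : Type uQ} {C : Type uC} {Act : Type uA} {L : Type uL}
  (M : BuchiAutomaton Q (Set C))

theorem WordEquiv.symm {w w' : List (Set C)} (h : M.WordEquiv w w') : M.WordEquiv w' w :=
  fun p q b => (h p q b).symm

theorem WordEquiv.trans {w w' w'' : List (Set C)} (h : M.WordEquiv w w')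
    (h' : M.WordEquiv w' w'') : M.WordEquiv w w'' :=
  fun p q b => (h p q b).trans (h' p q b)

theorem OmegaEquiv.symm {w w' : ℕ → Set C} (h : M.OmegaEquiv w w') : M.OmegaEquiv w' w :=
  fun p => (h p).symm

theorem OmegaEquiv.trans {w w' w'' : ℕ → Set C} (h : M.OmegaEquiv w w')
    (h' : M.OmegaEquiv w' w'') : M.OmegaEquiv w w'' :=
  fun p => (h p).trans (h' p)

theorem MEquiv.refl (𝓥 : HGV C Act L) : M.MEquiv 𝓥 𝓥 :=
  ⟨HGV.Coupling.refl 𝓥, fun _ _ _ _ => Iff.rfl,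
    fun _ _ => ⟨fun a ha => ⟨a, ha, fun _ _ _ => Iff.rfl⟩, fun a ha => ⟨a, ha, fun _ _ _ => Iff.rfl⟩⟩,
    fun _ => ⟨fun a ha => ⟨a, ha, fun _ => Iff.rfl⟩, fun a ha => ⟨a, ha, fun _ => Iff.rfl⟩⟩⟩

theorem MEquiv.symm {𝓥 𝓥' : HGV C Act L} (h : M.MEquiv 𝓥 𝓥') : M.MEquiv 𝓥' 𝓥 := by
  obtain ⟨κ, h1, h2, h3⟩ := h
  have key : ∀ x, κ.ν (κ.symm.ν x) = x := fun x => κ.ν.apply_symm_apply x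
  refine ⟨κ.symm, fun x => ?_, fun x y => ?_, fun x => ?_⟩
  · have := h1 (κ.symm.ν x)
    rw [key] at this
    exact WordEquiv.symm M this
  · have := h2 (κ.symm.ν x) (κ.symm.ν y)
    rw [key, key] at this
    exact this.symm fun _ _ => WordEquiv.symm M
  · have := h3 (κ.symm.ν x)
    rw [key] at this
    exact this.symm fun _ _ => OmegaEquiv.symm M

theorem MEquiv.trans {𝓥 𝓥' 𝓥'' : HGV C Act L} (h : M.MEquiv 𝓥 𝓥') (h' : M.MEquiv 𝓥' 𝓥'') :
    M.MEquiv 𝓥 𝓥'' := by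
  obtain ⟨κ, h1, h2, h3⟩ := h
  obtain ⟨κ', h1', h2', h3'⟩ := h'
  exact ⟨κ.trans κ', fun x => WordEquiv.trans M (h1 x) (h1' _),
    fun x y => (h2 x y).trans
      (fun a b c => WordEquiv.trans M (w := a) (w' := b) (w'' := c)) (h2' _ _),
    fun x => (h3 x).trans (fun a b c => OmegaEquiv.trans M (w := a) (w' := b) (w'' := c)) (h3' _)⟩

theorem cls_eq {𝓥 𝓥' : HGV C Act L} (h : M.MEquiv 𝓥 𝓥') : M.cls 𝓥 = M.cls 𝓥' :=
  Set.ext fun _ => ⟨fun g => MEquiv.trans M (MEquiv.symm M h) g, fun g => MEquiv.trans M h g⟩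

def beh (w : List (Set C)) : Set (Q × Q × Bool) := {t | M.DeltaStar t.1 w t.2.1 t.2.2}

def omegaBeh (w : ℕ → Set C) : Set Q := {p | M.DeltaOmega p w true}

theorem wordEquiv_of_beh {w w' : List (Set C)} (h : M.beh w = M.beh w') : M.WordEquiv w w' :=
  fun p q b => (Set.ext_iff.1 h (p, q, b))

theorem omegaEquiv_of_beh {w w' : ℕ → Set C} (h : M.omegaBeh w = M.omegaBeh w') :
    M.OmegaEquiv w w' :=
  fun p => (Set.ext_iff.1 h p)

/-- Views with empty `U`, `n` abstract nodes and `m` hyperedges of the given ranks. -/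
structure Shape (𝓥 : HGV C Act L) (n m : ℕ) (rk : Fin m → ℕ) where
  U_eq : 𝓥.U = ∅
  n_eq : 𝓥.H.n = n
  φ : Fin m ≃ 𝓥.H.E
  rank_eq : ∀ j, 𝓥.H.rank (φ j) = rk j

/-- Enumeration of the exposed nodes. -/
def Shape.idx {𝓥 : HGV C Act L} {n m : ℕ} {rk : Fin m → ℕ} (s : Shape 𝓥 n m rk) :
    Fin n ⊕ (Σ j, Fin (rk j)) → 𝓥.X
  | Sum.inl i => ⟨Sum.inr (Fin.cast s.n_eq.symm i), 𝓥.abs_mem_X _⟩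
  | Sum.inr d => ⟨𝓥.H.att (s.φ d.1) (Fin.cast (s.rank_eq d.1).symm d.2), 𝓥.att_mem_X _ _⟩

theorem Shape.idx_surjective {𝓥 : HGV C Act L} {n m : ℕ} {rk : Fin m → ℕ}
    (s : Shape 𝓥 n m rk) : Function.Surjective s.idx := by
  rintro ⟨v | i, hx⟩
  · rcases hx v rfl with h | h
    · rw [s.U_eq] at h
      exact absurd h (notMem_empty v)
    · simp only [HG.UA, mem_ofPred_eq, not_forall, not_not] at h
      obtain ⟨e, i, h⟩ := h
      refine ⟨Sum.inr ⟨s.φ.symm e, Fin.cast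
        (by rw [← s.rank_eq, Equiv.apply_symm_apply]) i⟩, Subtype.ext ?_⟩
      have hφ : s.φ (s.φ.symm e) = e := s.φ.apply_symm_apply e
      exact Eq.trans (HGV.Coupling.att_congr 𝓥 hφ _ i rfl) h
  · exact ⟨Sum.inl (Fin.cast s.n_eq i), rfl⟩

abbrev Code (Q : Type uQ) (ι : Type) : Type uQ :=
  (ι → ι → Prop) × (ι → Set (Q × Q × Bool)) × (ι → ι → Set (Set (Q × Q × Bool))) ×
    (ι → Set (Set Q))

/-- The finite information that determines the class of a view of the given shape. -/
def Shape.code {𝓥 : HGV C Act L} {n m : ℕ} {rk : Fin m → ℕ} (s : Shape 𝓥 n m rk) :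
    Code Q (Fin n ⊕ (Σ j, Fin (rk j))) :=
  (fun a b => s.idx a = s.idx b,
    fun a => M.beh (𝓥.H.nodeWord (s.idx a).1),
    fun a b => M.beh '' 𝓥.H.finTraces (s.idx a).1 (s.idx b).1,
    fun a => M.omegaBeh '' 𝓥.H.infTraces (s.idx a).1)

theorem Shape.mequiv {𝓥 𝓥' : HGV C Act L} {n m : ℕ} {rk : Fin m → ℕ} (s : Shape 𝓥 n m rk)
    (s' : Shape 𝓥' n m rk) (h : s.code M = s'.code M) : M.MEquiv 𝓥 𝓥' := by
  simp only [Shape.code, Prod.mk.injEq] at h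
  obtain ⟨h0, h1, h2, h3⟩ := h
  have h0 : ∀ a b, s.idx a = s.idx b ↔ s'.idx a = s'.idx b :=
    fun a b => iff_of_eq (congrFun (congrFun h0 a) b)
  let g := Function.surjInv s.idx_surjective
  let g' := Function.surjInv s'.idx_surjective
  have hg : ∀ x, s.idx (g x) = x := Function.surjInv_eq s.idx_surjective
  have hg' : ∀ x, s'.idx (g' x) = x := Function.surjInv_eq s'.idx_surjective
  let ν : 𝓥.X ≃ 𝓥'.X :=
    { toFun := fun x => s'.idx (g x)
      invFun := fun x => s.idx (g' x)
      left_inv := fun x => by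
        conv_rhs => rw [← hg x]
        rw [h0, hg']
      right_inv := fun x => by
        conv_rhs => rw [← hg' x]
        rw [← h0, hg] }
  have hν : ∀ a, ν (s.idx a) = s'.idx a := fun a => (h0 _ _).1 (hg _)
  have hr : ∀ e, 𝓥.H.rank e = 𝓥'.H.rank (s'.φ (s.φ.symm e)) := fun e => by
    rw [s'.rank_eq, ← s.rank_eq, Equiv.apply_symm_apply]
  have hU : IsEmpty 𝓥.U := by rw [s.U_eq]; infer_instance
  have hU' : IsEmpty 𝓥'.U := by rw [s'.U_eq]; infer_instance
  refine ⟨⟨Equiv.equivOfIsEmpty _ _, s.φ.symm.trans s'.φ, ν, s.n_eq.trans s'.n_eq.symm, hr,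
    fun i => ?_, fun v => hU.elim v, fun e i => ?_⟩, ?_, ?_, ?_⟩
  · exact congrArg Subtype.val (hν (Sum.inl (Fin.cast s.n_eq i)))
  · have hre : rk (s.φ.symm e) = 𝓥.H.rank e := by
      rw [← s.rank_eq, Equiv.apply_symm_apply]
    have hi : s.idx (Sum.inr ⟨s.φ.symm e, Fin.cast hre.symm i⟩) =
        ⟨𝓥.H.att e i, 𝓥.att_mem_X e i⟩ :=
      Subtype.ext (HGV.Coupling.att_congr 𝓥 (by simp) _ _ rfl)
    rw [← hi, hν]
    rfl
  · intro x
    obtain ⟨a, rfl⟩ := s.idx_surjective x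
    change M.WordEquiv _ (𝓥'.H.nodeWord (ν (s.idx a)).1)
    rw [hν]
    exact M.wordEquiv_of_beh (congrFun h1 a)
  · intro x y
    obtain ⟨a, rfl⟩ := s.idx_surjective x
    obtain ⟨b, rfl⟩ := s.idx_surjective y
    change SetEquiv _ _ (𝓥'.H.finTraces (ν (s.idx a)).1 (ν (s.idx b)).1)
    rw [hν, hν]
    exact SetEquiv.of_image M.beh (fun _ _ => M.wordEquiv_of_beh) (congrFun (congrFun h2 a) b)
  · intro x
    obtain ⟨a, rfl⟩ := s.idx_surjective x
    change SetEquiv _ _ (𝓥'.H.infTraces (ν (s.idx a)).1)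
    rw [hν]
    exact SetEquiv.of_image M.omegaBeh (fun _ _ => M.omegaEquiv_of_beh) (congrFun h3 a)

theorem finite_cls [Finite Q] (n m : ℕ) (rk : Fin m → ℕ) :
    {c | ∃ 𝓥 : HGV C Act L, Nonempty (Shape 𝓥 n m rk) ∧ c = M.cls 𝓥}.Finite := by
  classical
  let g : Code Q (Fin n ⊕ (Σ j, Fin (rk j))) → Set (HGV C Act L) := fun k =>
    {𝓤 | ∃ 𝓥 : HGV C Act L, ∃ s : Shape 𝓥 n m rk, s.code M = k ∧ 𝓤 ∈ M.cls 𝓥}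
  refine (Set.finite_range g).subset ?_
  rintro c ⟨𝓥, ⟨s⟩, rfl⟩
  refine ⟨s.code M, Set.ext fun 𝓤 => ⟨?_, fun h => ⟨𝓥, s, rfl, h⟩⟩⟩
  rintro ⟨𝓥', s', h, h'⟩
  rwa [← M.cls_eq (Shape.mequiv M s' s h)]

end BuchiAutomaton

/-! ### Hyperedge replacement grammars -/

/-- Hyperedge replacement grammars with nonterminals `nts ⊆ N`. -/
structure HRG (C : Type uC) (Act : Type uA) (N : Type uL) where
  ar : N → ℕ
  nts : Set N
  finite_nts : nts.Finite
  start : Set N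
  start_subset : start ⊆ nts
  rules : Set (N × HG C Act N)
  rules_ok : ∀ ρ ∈ rules, ρ.1 ∈ nts ∧ ρ.2.n = ar ρ.1 ∧
    ∀ e, ρ.2.lab e ∈ nts ∧ ρ.2.rank e = ar (ρ.2.lab e)

namespace HRG

variable {C : Type uC} {Act : Type uA} {N : Type uL}

/-- Partial derivation trees. -/
inductive Tree (G : HRG C Act N) : N → Type (max 1 uC uA uL)
  | leaf (A : N) : Tree G A
  | node {A : N} (R : HG C Act N) (hR : (A, R) ∈ G.rules)
      (sub : (e : R.E) → Tree G (R.lab e)) : Tree G A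

namespace Tree

variable {G : HRG C Act N}

/-- The tree has no premature leaf. -/
def Complete {A : N} : Tree G A → Prop
  | leaf _ => False
  | node _ _ sub => ∀ e, (sub e).Complete

/-- The tree has exactly one premature leaf, and this leaf is `B`. -/
def HasHole (B : N) {A : N} : Tree G A → Prop
  | leaf A => A = B
  | node _ _ sub => ∃ e, (sub e).HasHole B ∧ ∀ e', e' ≠ e → (sub e').Complete

/-- The hypergraph assembled from a derivation tree of `A`; it has `ar A` abstract nodes. -/
def sem {A : N} : Tree G A → {H : HG C Act N // H.n = G.ar A}
  | leaf A => ⟨HG.handle A (G.ar A), rfl⟩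
  | node R hR sub =>
    ⟨R.repl (fun e => ((sub e).sem).1)
      (fun e => ((sub e).sem).2.trans ((G.rules_ok _ hR).2.2 e).2.symm),
      (G.rules_ok _ hR).2.1⟩

end Tree

/-- The hypergraphs (up to isomorphism) derived from the nonterminal `A`. -/
def langOf (G : HRG C Act N) (A : N) : Set (HG C Act N) :=
  {H | ∃ T : Tree G A, T.Complete ∧ Nonempty (HG.Iso H T.sem.1)}

/-- The language of the grammar. -/
def language (G : HRG C Act N) : Set (HG C Act N) :=
  {H | ∃ A ∈ G.start, H ∈ G.langOf A}

/-- The contexts (up to isomorphism) of the nonterminal `B`. -/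
def contexts (G : HRG C Act N) (B : N) : Set (HG C Act N) :=
  {H | ∃ A ∈ G.start, ∃ T : Tree G A, T.HasHole B ∧ Nonempty (HG.Iso H T.sem.1)}

end HRG

/-! ### Refinement and recoloring -/

namespace HRG

variable {C : Type uC} {Act : Type uA} {N : Type uL} {Q : Type uQ}

theorem Tree.isEmpty_of_complete {G : HRG C Act N} {A : N} (T : Tree G A) (hT : T.Complete) :
    IsEmpty T.sem.1.E := by
  induction T with
  | leaf A => exact hT.elim
  | node R hR sub ih => exact ⟨fun d => (ih d.1 (hT d.1)).elim d.2⟩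

theorem Tree.exists_hole {G : HRG C Act N} {A B : N} (T : Tree G A) (hT : T.HasHole B) :
    ∃ e : T.sem.1.E, (∀ e', e' = e) ∧ T.sem.1.rank e = G.ar B := by
  induction T with
  | leaf A => exact ⟨(), fun _ => rfl, congrArg G.ar hT⟩
  | node R hR sub ih =>
    obtain ⟨e, he, hc⟩ := hT
    obtain ⟨d, hd, hr⟩ := ih e he
    refine ⟨⟨e, d⟩, fun d' => ?_, hr⟩
    obtain ⟨e', d'⟩ := d'
    by_cases h : e' = e
    · subst h
      rw [hd d']
    · exact ((Tree.isEmpty_of_complete _ (hc e' h)).false d').elim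

variable (G : HRG C Act N) (M : BuchiAutomaton Q (Set C))

/-- Nonterminals of the grammar refined by `M`-equivalence: triples `(A, 𝔖, ℭ)` of a nonterminal,
a class of hypergraphs derived from it, and a class of its contexts. -/
def refinedNts : Set (N × Set (HGV C Act N) × Set (HGV C Act N)) :=
  {t | t.1 ∈ G.nts ∧ (∃ H ∈ G.langOf t.1, t.2.1 = M.cls (HGV.trivial H)) ∧
    ∃ J ∈ G.contexts t.1, t.2.2 = M.cls (HGV.trivial J)}

theorem finite_refinedNts [Finite Q] : (G.refinedNts M).Finite := by
  have h1 : ∀ A, {c | ∃ H ∈ G.langOf A, c = M.cls (HGV.trivial H)}.Finite := fun A => by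
    refine (M.finite_cls (Act := Act) (L := N) (G.ar A) 0 (fun _ => 0)).subset ?_
    rintro c ⟨H, ⟨T, hT, ⟨ι⟩⟩, rfl⟩
    have := T.isEmpty_of_complete hT
    have : IsEmpty H.E := ι.onE.isEmpty
    exact ⟨_, ⟨rfl, ι.n_eq.trans T.sem.2, Equiv.equivOfIsEmpty _ H.E, fun j => j.elim0⟩, rfl⟩
  have h2 : ∀ A, {c | ∃ J ∈ G.contexts A, c = M.cls (HGV.trivial J)}.Finite := fun A => by
    refine ((G.finite_nts.subset G.start_subset).biUnion fun S _ =>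
      M.finite_cls (Act := Act) (L := N) (G.ar S) 1 (fun _ => G.ar A)).subset ?_
    rintro c ⟨J, ⟨S, hS, T, hT, ⟨ι⟩⟩, rfl⟩
    obtain ⟨e, he, hr⟩ := T.exists_hole hT
    refine mem_biUnion hS ⟨_, ⟨rfl, ι.n_eq.trans T.sem.2,
      ⟨fun _ => ι.onE.symm e, fun _ => 0, fun _ => Subsingleton.elim _ _, fun d => ?_⟩,
      fun j => ?_⟩, rfl⟩
    · change ι.onE.symm e = d
      exact (Equiv.symm_apply_eq _).2 (he _).symm
    · change J.rank (ι.onE.symm e) = _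
      rw [ι.rank_eq, Equiv.apply_symm_apply, hr]
  refine (G.finite_nts.biUnion fun A _ =>
    (Set.finite_singleton A).prod ((h1 A).prod (h2 A))).subset ?_
  rintro ⟨A, s, c⟩ ⟨hA, hs, hc⟩
  exact mem_biUnion hA ⟨rfl, hs, hc⟩

/-- `c` is the class `U[𝔗]`: the class of a view obtained by replacing the hyperedges of `𝓤`
by representatives of the classes `𝔗 e`. -/
def IsReplClass (𝓤 : HGV C Act N) (𝔗 : 𝓤.H.E → Set (HGV C Act N)) (c : Set (HGV C Act N)) :
    Prop :=
  ∃ (K : 𝓤.H.E → HGV C Act N) (hK : ∀ e, (K e).H.n = 𝓤.H.rank e),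
    (∀ e, K e ∈ 𝔗 e) ∧ c = M.cls (𝓤.repl K hK)

/-- `d` is the class `ℭ[𝔅]`: the class of a view obtained by replacing the only hyperedge of a
representative of `ℭ` by a representative of `𝔅`. -/
def IsPlugClass (ℭ 𝔅 d : Set (HGV C Act N)) : Prop :=
  ∃ J ∈ ℭ, ∃ B ∈ 𝔅, Nonempty (Unique J.H.E) ∧
    ∃ h : ∀ e, B.H.n = J.H.rank e, d = M.cls (J.repl (fun _ => B) h)

open Classical in
/-- The rules of the refined grammar. In a rule `((A, 𝔖, ℭ), R)`, a hyperedge `e` has a label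
`(B e, 𝔗 e, 𝔇 e)`, and forgetting the classes gives a rule of `G`. The classes satisfy
`𝔖 = (R, ∅)[𝔗]`, and `𝔇 e` is the class `ℭ[(R, ∅)[𝔗']]`, where `𝔗'` agrees with `𝔗` except that
it assigns the handle of `B e` to `e`. -/
def refinedRules : Set ((N × Set (HGV C Act N) × Set (HGV C Act N)) ×
    HG C Act (N × Set (HGV C Act N) × Set (HGV C Act N))) :=
  {ρ | (ρ.1.1, ρ.2.mapLab Prod.fst) ∈ G.rules ∧
    ρ.1 ∈ G.refinedNts M ∧ (∀ e, ρ.2.lab e ∈ G.refinedNts M) ∧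
    IsReplClass M (HGV.trivial (ρ.2.mapLab Prod.fst)) (fun e => (ρ.2.lab e).2.1) ρ.1.2.1 ∧
    ∀ e, ∃ 𝔅, IsReplClass M (HGV.trivial (ρ.2.mapLab Prod.fst))
        (Function.update (fun e => (ρ.2.lab e).2.1) e
          (M.cls (HGV.trivial (HG.handle (ρ.2.lab e).1 (G.ar (ρ.2.lab e).1))))) 𝔅 ∧
      IsPlugClass M ρ.1.2.2 𝔅 (ρ.2.lab e).2.2}

/-- The grammar refined by `M`-equivalence. -/
def refined [Finite Q] : HRG C Act (N × Set (HGV C Act N) × Set (HGV C Act N)) where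
  ar t := G.ar t.1
  nts := G.refinedNts M
  finite_nts := G.finite_refinedNts M
  start := {t | t ∈ G.refinedNts M ∧ t.1 ∈ G.start ∧
    t.2.2 = M.cls (HGV.trivial (HG.handle t.1 (G.ar t.1)))}
  start_subset := fun _ h => h.1
  rules := G.refinedRules M
  rules_ok := fun _ h => ⟨h.2.1, (G.rules_ok _ h.1).2.1,
    fun e => ⟨h.2.2.1 e, ((G.rules_ok _ h.1).2.2 e).2⟩⟩

/-- `(ℭ[(R, UA)[𝔗]], v) ⊨ M` for a concrete node `v` of `R`: for representatives `J` of `ℭ` and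
`K e` of `𝔗 e`, the copy of `v` in `J[(R, UA)[K]]` satisfies `M`. -/
def ClassSat (ℭ : Set (HGV C Act N)) (R : HG C Act N) (𝔗 : R.E → Set (HGV C Act N)) (v : R.V) :
    Prop :=
  ∃ J ∈ ℭ, ∃ u : Unique J.H.E, ∃ K : R.E → HGV C Act N, (∀ e, K e ∈ 𝔗 e) ∧
    ∃ (hK : ∀ e, (K e).H.n = R.rank e) (hJ : ∀ e, R.n = J.H.rank e),
      HG.Sat M (J.repl (fun _ => (HGV.full R).repl K hK) hJ).H
        (Sum.inl (Sum.inr ⟨u.default, Sum.inl v⟩))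

/-- The `M`-recolored grammar. Its node colors are `Option C`, where `none` is the new color `M`.
Its rules are the rules of the refined grammar in which a concrete node `v` additionally gets the
new color iff `(ℭ[(R, UA)[𝔗]], v) ⊨ M`. -/
def recolor [Finite Q] :
    HRG (Option C) Act (N × Set (HGV C Act N) × Set (HGV C Act N)) where
  ar := (G.refined M).ar
  nts := (G.refined M).nts
  finite_nts := (G.refined M).finite_nts
  start := (G.refined M).start
  start_subset := (G.refined M).start_subset
  rules := {ρ | (ρ.1, ρ.2.del) ∈ (G.refined M).rules ∧
    ∀ v, none ∈ ρ.2.color v ↔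
      ClassSat M ρ.1.2.2 (ρ.2.del.mapLab Prod.fst) (fun e => (ρ.2.lab e).2.1) v}
  rules_ok := fun _ h => (G.refined M).rules_ok _ h.1

end HRG

/-! The core is that `M`-equivalence is a congruence for hyperedge replacement. A path through
`H[K]` is cut at attached nodes into pieces inside `H` and pieces inside single hypergraphs `K e`.
Pieces between coupled nodes can be exchanged for `M`-equivalent ones in an equivalent view, and
equivalence of words survives concatenation. An infinite path either returns from the `K e` to outer
nodes only finitely often, and then has a tail inside `H` or inside one `K e`, or it is an infinite
concatenation of such pieces. In the second case an accepting run is exchanged piece by piece: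
equivalence keeps the end states of each piece and the bit that records a visit to a final state, so
acceptance survives (`BuchiAutomaton.deltaOmega_blocks`). One direction of the congruence is
`ReplSim.halfSim`; both together give `RelEquiv.repl`.

The theorem then follows by induction on derivation trees of the recolored grammar. Bottom-up, the
second component of a nonterminal is the class of the hypergraph that its subtree denotes
(`HRG.recolor_cls_sem`). Top-down, the third component is the class of the context in which this
hypergraph sits: at the root it is a handle, and below a rule `R` the context of `e` is `J[R[K]]`
with a handle in place of `K e`, whose class is the one the rule prescribes (`exists_context`).
Hence the classes tested by a rule are those of the actual surroundings, and the result of the test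
does not depend on representatives (`sat_congr`). `HRG.recolor_color_iff` combines these facts for
an arbitrary context; plugging a hypergraph into the handle at the root gives it back. -/

/-! ### Gluing blocks of sequences -/

/-- The position at which block `n` starts when blocks of lengths `len 0, len 1, …` are
concatenated. -/
def blockStart (len : ℕ → ℕ) : ℕ → ℕ
  | 0 => 0
  | n + 1 => blockStart len n + len n

theorem blockStart_mono (len : ℕ → ℕ) : Monotone (blockStart len) :=
  monotone_nat_of_le_succ fun _ => Nat.le_add_right _ _

theorem le_blockStart {len : ℕ → ℕ} (hlen : ∀ n, 0 < len n) (n : ℕ) : n ≤ blockStart len n := by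
  induction n with
  | zero => exact Nat.zero_le _
  | succ n ih =>
    have := hlen n
    simp only [blockStart]
    omega

theorem exists_block {len : ℕ → ℕ} (hlen : ∀ n, 0 < len n) (i : ℕ) :
    ∃ n j, j < len n ∧ i = blockStart len n + j := by
  induction i with
  | zero => exact ⟨0, 0, hlen 0, rfl⟩
  | succ i ih =>
    obtain ⟨n, j, hj, rfl⟩ := ih
    rcases Nat.lt_or_ge (j + 1) (len n) with h | h
    · exact ⟨n, j + 1, h, rfl⟩
    · refine ⟨n + 1, 0, hlen _, ?_⟩
      simp only [blockStart]
      omega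

theorem block_unique {len : ℕ → ℕ} {n m j k : ℕ} (hj : j < len n) (hk : k < len m)
    (h : blockStart len n + j = blockStart len m + k) : n = m ∧ j = k := by
  have key : ∀ n m j k, j < len n → blockStart len n + j = blockStart len m + k → ¬ n < m := by
    intro n m j k hj h hnm
    have := blockStart_mono len (Nat.succ_le_of_lt hnm)
    simp only [blockStart] at this
    omega
  obtain rfl : n = m := by
    have h1 := key n m j k hj h
    have h2 := key m n k j hk h.symm
    omega
  exact ⟨rfl, by omega⟩

/-- Every position has a unique block and offset below the block's length. The end point `j = len n`
belongs to the next block at offset `0`, which is where `h` is needed. -/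
theorem exists_glue {α : Type*} {len : ℕ → ℕ} (hlen : ∀ n, 0 < len n) (r : ℕ → ℕ → α)
    (h : ∀ n, r n (len n) = r (n + 1) 0) :
    ∃ f : ℕ → α, ∀ n j, j ≤ len n → f (blockStart len n + j) = r n j := by
  choose b o ho hb using exists_block hlen
  have key : ∀ n j, j < len n → r (b (blockStart len n + j)) (o (blockStart len n + j)) = r n j := by
    intro n j hj
    obtain ⟨h1, h2⟩ := block_unique (ho _) hj (hb (blockStart len n + j)).symm
    rw [h1, h2]
  refine ⟨fun i => r (b i) (o i), fun n j hj => ?_⟩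
  rcases Nat.lt_or_eq_of_le hj with hj | rfl
  · exact key n j hj
  · exact (key (n + 1) 0 (hlen _)).trans (h n).symm

/-! ### Infinite words with finite prefixes -/

section prepend

variable {α : Type*}

theorem prependWord_nil (s : ℕ → α) : prependWord [] s = s := by
  funext i
  simp [prependWord]

theorem prependWord_getElem {l : List α} (s : ℕ → α) {i : ℕ} (h : i < l.length) :
    prependWord l s i = l[i] := by
  simp [prependWord, h]

theorem prependWord_add (l : List α) (s : ℕ → α) (i : ℕ) :
    prependWord l s (l.length + i) = s i := by
  simp [prependWord]

theorem prependWord_append (l l' : List α) (s : ℕ → α) :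
    prependWord (l ++ l') s = prependWord l (prependWord l' s) := by
  funext i
  rcases Nat.lt_or_ge i l.length with h | h
  · have h' : i < (l ++ l').length := by rw [List.length_append]; omega
    rw [prependWord_getElem _ h, prependWord_getElem _ h', List.getElem_append_left h]
  · obtain ⟨j, rfl⟩ := Nat.exists_eq_add_of_le h
    rw [prependWord_add]
    rcases Nat.lt_or_ge j l'.length with h2 | h2
    · have h' : l.length + j < (l ++ l').length := by rw [List.length_append]; omega
      rw [prependWord_getElem _ h', prependWord_getElem _ h2, List.getElem_append_right h]
      simp
    · obtain ⟨k, rfl⟩ := Nat.exists_eq_add_of_le h2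
      rw [prependWord_add, ← Nat.add_assoc, ← List.length_append, prependWord_add]

theorem eq_of_prependWord_blocks {w : ℕ → ℕ → α} {a : ℕ → List α}
    (hw : ∀ n, w n = prependWord (a n) (w (n + 1))) (n i : ℕ) :
    w 0 (blockStart (fun n => (a n).length) n + i) = w n i := by
  induction n generalizing i with
  | zero => simp [blockStart]
  | succ n ih => rw [blockStart, Nat.add_assoc, ih, hw n, prependWord_add]

end prepend

namespace BuchiAutomaton

variable {Q : Type uQ} {C : Type uC} (M : BuchiAutomaton Q (Set C))

/-! ### Congruence properties of word equivalence -/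

theorem WordEquiv.refl (w : List (Set C)) : M.WordEquiv w w := fun _ _ _ => Iff.rfl

/-- The state at the cut is counted in both halves; this does no harm because the two bits are
joined by a disjunction. -/
theorem deltaStar_append {p q : Q} {a b : List (Set C)} {c : Bool} :
    M.DeltaStar p (a ++ b) q c ↔
      ∃ r c₁ c₂, M.DeltaStar p a r c₁ ∧ M.DeltaStar r b q c₂ ∧ c = (c₁ || c₂) := by
  classical
  constructor
  · rintro ⟨r, h0, hl, hs, hc⟩
    refine ⟨r a.length, decide (∃ i, i ≤ a.length ∧ r i ∈ M.final),
      decide (∃ i, i ≤ b.length ∧ r (a.length + i) ∈ M.final),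
      ⟨r, h0, rfl, fun i hi => ?_, by simp⟩,
      ⟨fun i => r (a.length + i), rfl, by simpa using hl, fun i hi => ?_, by simp⟩, ?_⟩
    · have := hs i (by rw [List.length_append]; omega)
      rwa [List.getElem_append_left hi] at this
    · have := hs (a.length + i) (by rw [List.length_append]; omega)
      rw [List.getElem_append_right (by omega)] at this
      simpa [Nat.add_assoc] using this
    · rw [Bool.eq_iff_iff, hc]
      simp only [Bool.or_eq_true, decide_eq_true_eq, List.length_append]
      constructor
      · rintro ⟨i, hi, hf⟩
        rcases Nat.le_total i a.length with h | h
        · exact Or.inl ⟨i, h, hf⟩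
        · exact Or.inr ⟨i - a.length, by omega, by rwa [Nat.add_sub_cancel' h]⟩
      · rintro (⟨i, hi, hf⟩ | ⟨i, hi, hf⟩)
        · exact ⟨i, by omega, hf⟩
        · exact ⟨a.length + i, by omega, hf⟩
  · rintro ⟨r, c₁, c₂, ⟨r₁, h0, hl, hs, hc₁⟩, ⟨r₂, h0', hl', hs', hc₂⟩, rfl⟩
    have e1 : ∀ i, i ≤ a.length → (if i ≤ a.length then r₁ i else r₂ (i - a.length)) = r₁ i :=
      fun i hi => if_pos hi
    -- At `i = 0` the first branch applies; the two runs agree there since both are in state `r`.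
    have e2 : ∀ i, (if a.length + i ≤ a.length then r₁ (a.length + i)
        else r₂ (a.length + i - a.length)) = r₂ i := fun i => by
      rcases Nat.eq_zero_or_pos i with rfl | hi
      · simp [hl, h0']
      · rw [if_neg (by omega), Nat.add_sub_cancel_left]
    refine ⟨fun i => if i ≤ a.length then r₁ i else r₂ (i - a.length), ?_, ?_, fun i hi => ?_, ?_⟩
    · exact (e1 0 (Nat.zero_le _)).trans h0
    · simp only [List.length_append]
      exact (e2 _).trans hl'
    · rw [List.length_append] at hi
      simp only
      rcases Nat.lt_or_ge i a.length with h | h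
      · rw [e1 i h.le, e1 (i + 1) h, List.getElem_append_left h]
        exact hs i h
      · obtain ⟨j, rfl⟩ := Nat.exists_eq_add_of_le h
        rw [e2 j, Nat.add_assoc, e2 (j + 1), List.getElem_append_right h]
        simpa using hs' j (by omega)
    · rw [Bool.or_eq_true, hc₁, hc₂, List.length_append]
      constructor
      · rintro (⟨i, hi, hf⟩ | ⟨i, hi, hf⟩)
        · exact ⟨i, by omega, by simp only; rwa [e1 i hi]⟩
        · exact ⟨a.length + i, by omega, by simp only; rwa [e2 i]⟩
      · rintro ⟨i, hi, hf⟩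
        simp only at hf
        rcases Nat.le_total i a.length with h | h
        · exact Or.inl ⟨i, h, by rwa [e1 i h] at hf⟩
        · obtain ⟨j, rfl⟩ := Nat.exists_eq_add_of_le h
          exact Or.inr ⟨j, by omega, by rwa [e2 j] at hf⟩

theorem WordEquiv.append {a a' b b' : List (Set C)} (h : M.WordEquiv a a')
    (h' : M.WordEquiv b b') : M.WordEquiv (a ++ b) (a' ++ b') := by
  intro p q c
  simp only [deltaStar_append, h _ _ _, h' _ _ _]

/-- Pigeonhole: with finitely many states, infinitely many visits to the set of final states make
one final state recur. The right-hand side is easier to transfer between runs. -/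
theorem infinite_visits_iff [Finite Q] (r : ℕ → Q) :
    (∃ f ∈ M.final, {i | r i = f}.Infinite) ↔ ∀ n, ∃ i, n ≤ i ∧ r i ∈ M.final := by
  constructor
  · rintro ⟨f, hf, hi⟩ n
    obtain ⟨i, hi, hn⟩ := hi.exists_gt n
    exact ⟨i, hn.le, by rw [show r i = f from hi]; exact hf⟩
  · intro h
    by_contra hc
    push Not at hc
    have hfin : (⋃ f ∈ M.final, {i | r i = f}).Finite :=
      (Set.toFinite M.final).biUnion fun f hf => hc f hf
    obtain ⟨n, hn⟩ := hfin.bddAbove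
    obtain ⟨i, hi, hf⟩ := h (n + 1)
    have : i ≤ n := hn (mem_biUnion hf rfl)
    omega

theorem deltaOmega_true_iff [Finite Q] {p : Q} {w : ℕ → Set C} :
    M.DeltaOmega p w true ↔ ∃ r : ℕ → Q, r 0 = p ∧ (∀ i, (r i, w i, r (i + 1)) ∈ M.Δ) ∧
      ∀ n, ∃ i, n ≤ i ∧ r i ∈ M.final := by
  simp only [DeltaOmega, ← infinite_visits_iff, true_iff]

/-- The bit `c` of the prefix is arbitrary, as finitely many positions do not influence acceptance.
-/
theorem deltaOmega_prependWord [Finite Q] {p : Q} {a : List (Set C)} {w : ℕ → Set C} :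
    M.DeltaOmega p (prependWord a w) true ↔
      ∃ r c, M.DeltaStar p a r c ∧ M.DeltaOmega r w true := by
  classical
  simp only [deltaOmega_true_iff]
  constructor
  · rintro ⟨r, h0, hs, hc⟩
    refine ⟨r a.length, decide (∃ i, i ≤ a.length ∧ r i ∈ M.final),
      ⟨r, h0, rfl, fun i hi => ?_, by simp⟩, fun i => r (a.length + i), rfl, fun i => ?_,
      fun n => ?_⟩
    · have := hs i
      rwa [prependWord_getElem _ hi] at this
    · have := hs (a.length + i)
      rwa [prependWord_add] at this
    · obtain ⟨i, hi, hf⟩ := hc (a.length + n)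
      exact ⟨i - a.length, by omega, by simpa only [Nat.add_sub_cancel' (show a.length ≤ i by omega)]⟩
  · rintro ⟨q, c, ⟨r₁, h0, hl, hs, -⟩, r₂, h0', hs', hc⟩
    have e1 : ∀ i, i ≤ a.length → (if i ≤ a.length then r₁ i else r₂ (i - a.length)) = r₁ i :=
      fun i hi => if_pos hi
    have e2 : ∀ i, (if a.length + i ≤ a.length then r₁ (a.length + i)
        else r₂ (a.length + i - a.length)) = r₂ i := fun i => by
      rcases Nat.eq_zero_or_pos i with rfl | hi
      · simp [hl, h0']
      · rw [if_neg (by omega), Nat.add_sub_cancel_left]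
    refine ⟨fun i => if i ≤ a.length then r₁ i else r₂ (i - a.length),
      (e1 0 (Nat.zero_le _)).trans h0, fun i => ?_, fun n => ?_⟩
    · simp only
      rcases Nat.lt_or_ge i a.length with h | h
      · rw [e1 i h.le, e1 (i + 1) h, prependWord_getElem _ h]
        exact hs i h
      · obtain ⟨j, rfl⟩ := Nat.exists_eq_add_of_le h
        rw [e2 j, Nat.add_assoc, e2 (j + 1), prependWord_add]
        exact hs' j
    · obtain ⟨i, hi, hf⟩ := hc n
      exact ⟨a.length + i, by omega, by simp only; rwa [e2 i]⟩

theorem OmegaEquiv.prependWord [Finite Q] {a a' : List (Set C)} {w w' : ℕ → Set C}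
    (h : M.WordEquiv a a') (h' : M.OmegaEquiv w w') :
    M.OmegaEquiv (_root_.prependWord a w) (_root_.prependWord a' w') := by
  intro p
  simp only [deltaOmega_prependWord, h _ _ _, h' _]

/-- An accepting run on `w 0` is cut at the block boundaries. Each segment is exchanged for one on
the equivalent block with the same end states and the same bit, and the new segments are glued. No
Ramsey argument is needed, since both words come with matching factorizations. -/
theorem deltaOmega_blocks [Finite Q] {w w' : ℕ → ℕ → Set C} {a a' : ℕ → List (Set C)}
    (hw : ∀ n, w n = prependWord (a n) (w (n + 1)))
    (hw' : ∀ n, w' n = prependWord (a' n) (w' (n + 1)))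
    (ha : ∀ n, a n ≠ []) (ha' : ∀ n, a' n ≠ []) (h : ∀ n, M.WordEquiv (a n) (a' n)) (p : Q)
    (hp : M.DeltaOmega p (w 0) true) : M.DeltaOmega p (w' 0) true := by
  classical
  rw [deltaOmega_true_iff] at hp ⊢
  obtain ⟨r, h0, hs, hc⟩ := hp
  let s := blockStart fun n => (a n).length
  let s' := blockStart fun n => (a' n).length
  have hlen : ∀ n, 0 < (a n).length := fun n => List.length_pos_iff.2 (ha n)
  have hlen' : ∀ n, 0 < (a' n).length := fun n => List.length_pos_iff.2 (ha' n)
  have hb : ∀ n, M.DeltaStar (r (s n)) (a n) (r (s (n + 1)))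
      (decide (∃ i, i ≤ (a n).length ∧ r (s n + i) ∈ M.final)) := fun n =>
    ⟨fun i => r (s n + i), rfl, rfl, fun i hi => by
      have := hs (s n + i)
      rwa [eq_of_prependWord_blocks hw, hw n, prependWord_getElem _ hi] at this, by simp⟩
  have hb' := fun n => (h n _ _ _).1 (hb n)
  choose r' h0' hl' hs' hc' using hb'
  obtain ⟨f, hf⟩ := exists_glue hlen' r' fun n => (hl' n).trans (h0' (n + 1)).symm
  refine ⟨f, ?_, fun i => ?_, fun n => ?_⟩
  · have := hf 0 0 (Nat.zero_le _)
    exact this.trans ((h0' 0).trans h0)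
  · obtain ⟨n, j, hj, rfl⟩ := exists_block hlen' i
    rw [hf n j hj.le, Nat.add_assoc, hf n (j + 1) hj, eq_of_prependWord_blocks hw', hw' n,
      prependWord_getElem _ hj]
    exact hs' n j hj
  · obtain ⟨i, hi, hif⟩ := hc (s n)
    obtain ⟨m, j, hj, rfl⟩ := exists_block hlen i
    -- A final state in block `m` of the old run makes the bit of this block true, hence yields a
    -- final state in block `m` of the new run.
    obtain ⟨k, hk, hkf⟩ := (hc' m).1 (decide_eq_true ⟨j, hj.le, hif⟩)
    have hnm : n ≤ m := by
      by_contra hlt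
      have := blockStart_mono (fun n => (a n).length) (Nat.succ_le_of_lt (not_le.1 hlt))
      simp only [blockStart] at this
      simp only [s] at hi
      omega
    refine ⟨s' m + k, ?_, by rw [hf m k hk]; exact hkf⟩
    -- Blocks are nonempty, so block `m` starts no earlier than position `m`, and `n ≤ m`.
    have := le_blockStart hlen' m
    simp only [s']
    omega

theorem OmegaEquiv.of_blocks [Finite Q] {w w' : ℕ → ℕ → Set C} {a a' : ℕ → List (Set C)}
    (hw : ∀ n, w n = _root_.prependWord (a n) (w (n + 1)))
    (hw' : ∀ n, w' n = _root_.prependWord (a' n) (w' (n + 1)))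
    (ha : ∀ n, a n ≠ []) (ha' : ∀ n, a' n ≠ []) (h : ∀ n, M.WordEquiv (a n) (a' n)) :
    M.OmegaEquiv (w 0) (w' 0) := fun p =>
  ⟨M.deltaOmega_blocks hw hw' ha ha' h p,
    M.deltaOmega_blocks hw' hw ha' ha (fun n => WordEquiv.symm M (h n)) p⟩

end BuchiAutomaton

namespace HG

variable {C : Type uC} {Act : Type uA} {L : Type uL} (H : HG C Act L)

/-! ### Paths and their color words -/

/-- `H.PT u n a v`: there is a path of length `n` from `u` to `v` with concrete inner nodes, and
`a` is the word of the colors of its nodes except the last one. -/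
inductive PT (u : H.W) : ℕ → List (Set C) → H.W → Prop
  | nil : PT u 0 [] u
  | snoc {n : ℕ} {a : List (Set C)} {x v : H.W} : PT u n a x → (n = 0 ∨ x.isLeft = true) →
      H.Step x v → PT u (n + 1) (a ++ H.nodeWord x) v

variable {H}

theorem PT.zero_inv {u v : H.W} {a : List (Set C)} (h : H.PT u 0 a v) : u = v ∧ a = [] := by
  cases h
  exact ⟨rfl, rfl⟩

theorem PT.trans {u v x : H.W} {n m : ℕ} {a b : List (Set C)} (h : H.PT u n a v)
    (hv : n = 0 ∨ v.isLeft = true) (h' : H.PT v m b x) : H.PT u (n + m) (a ++ b) x := by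
  induction h' with
  | nil => simpa using h
  | snoc h1 h2 h3 ih =>
    rw [← List.append_assoc, ← Nat.add_assoc]
    refine ih.snoc ?_ h3
    rcases h2 with rfl | h2
    · obtain ⟨rfl, -⟩ := h1.zero_inv
      simpa using hv
    · exact Or.inr h2

theorem PT.single {u v : H.W} (h : H.Step u v) : H.PT u 1 (H.nodeWord u) v :=
  PT.snoc PT.nil (Or.inl rfl) h

theorem PT.ne_nil {u v : H.W} {n : ℕ} {a : List (Set C)} (h : H.PT u n a v) (hn : 0 < n)
    (hu : u.isLeft = true) : a ≠ [] := by
  induction h with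
  | nil => exact absurd hn (lt_irrefl 0)
  | @snoc n a x v h1 h2 h3 ih =>
    rcases Nat.eq_zero_or_pos n with rfl | h
    · obtain ⟨rfl, rfl⟩ := h1.zero_inv
      obtain ⟨y, rfl⟩ := Sum.isLeft_iff.1 hu
      simp [nodeWord]
    · simp [ih h]

theorem PT.of_isChain {u v : H.W} (p : List H.V)
    (h : List.IsChain H.Step (u :: (p.map Sum.inl ++ [v]))) :
    H.PT u (p.length + 1) (H.nodeWord u ++ p.map H.color) v := by
  induction p generalizing u with
  | nil =>
    have : H.Step u v := by simpa using h
    simpa using PT.single this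
  | cons x p ih =>
    have h : H.Step u (Sum.inl x) ∧
        List.IsChain H.Step (Sum.inl x :: (p.map Sum.inl ++ [v])) := by simpa using h
    have := (PT.single h.1).trans (Or.inr rfl) (ih h.2)
    simpa [nodeWord, Nat.add_comm] using this

theorem PT.exists_isChain {u v : H.W} {n : ℕ} {a : List (Set C)} (h : H.PT u n a v)
    (hn : 0 < n) : ∃ p : List H.V, List.IsChain H.Step (u :: (p.map Sum.inl ++ [v])) ∧
      a = H.nodeWord u ++ p.map H.color := by
  induction h with
  | nil => exact absurd hn (lt_irrefl 0)
  | @snoc n a x v h1 h2 h3 ih =>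
    rcases Nat.eq_zero_or_pos n with rfl | h
    · obtain ⟨rfl, rfl⟩ := h1.zero_inv
      exact ⟨[], by simpa using h3, by simp⟩
    · obtain ⟨p, hp, rfl⟩ := ih h
      obtain ⟨y, rfl⟩ := Sum.isLeft_iff.1 (h2.resolve_left h.ne')
      refine ⟨p ++ [y], ?_, by simp [nodeWord]⟩
      have e : u :: ((p ++ [y]).map Sum.inl ++ [v]) =
          (u :: (p.map Sum.inl ++ [Sum.inl y])) ++ [v] := by simp
      rw [e, List.isChain_append]
      refine ⟨hp, List.isChain_singleton _, fun s hs t ht => ?_⟩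
      have e2 : u :: (p.map Sum.inl ++ [Sum.inl y]) =
        (u :: p.map Sum.inl) ++ [(Sum.inl y : H.W)] := by simp
      rw [e2, List.getLast?_concat] at hs
      obtain rfl : Sum.inl y = s := by simpa using hs
      obtain rfl : v = t := by simpa using ht
      exact h3

/-- Omitting the letter of the last node makes words concatenate when paths are composed; a trace is
recovered by appending that letter. -/
theorem mem_finTraces_iff {u v : H.W} {w : List (Set C)} :
    w ∈ H.finTraces u v ↔ ∃ n a, 0 < n ∧ H.PT u n a v ∧ w = a ++ H.nodeWord v := by
  constructor
  · rintro ⟨p, hp, rfl⟩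
    exact ⟨_, _, Nat.succ_pos _, PT.of_isChain p hp, rfl⟩
  · rintro ⟨n, a, hn, h, rfl⟩
    obtain ⟨p, hp, rfl⟩ := h.exists_isChain hn
    exact ⟨p, hp, rfl⟩

theorem prependWord_mem_infTraces_of_step {x v : H.W} {w : ℕ → Set C} (h : H.Step x v)
    (hv : v.isLeft = true) (hw : w ∈ H.infTraces v) :
    prependWord (H.nodeWord x) w ∈ H.infTraces x := by
  obtain ⟨p, h0, hs, rfl⟩ := hw
  obtain ⟨y, rfl⟩ := Sum.isLeft_iff.1 hv
  refine ⟨fun i => Nat.casesOn i y p, h, fun i => ?_, ?_⟩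
  · cases i with
    | zero => exact h0
    | succ i => exact hs i
  · congr 1
    funext i
    cases i with
    | zero => exact prependWord_getElem (l := [H.color y]) _ Nat.zero_lt_one
    | succ i =>
      have := prependWord_add [H.color y] (fun i => H.color (p i)) i
      rw [List.length_singleton, Nat.add_comm] at this
      exact this

theorem PT.prependWord_mem_infTraces {u v : H.W} {n : ℕ} {a : List (Set C)} {w : ℕ → Set C}
    (h : H.PT u n a v) (hv : n = 0 ∨ v.isLeft = true) (hw : w ∈ H.infTraces v) :
    prependWord a w ∈ H.infTraces u := by
  induction h generalizing w with
  | nil => rwa [prependWord_nil]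
  | snoc h1 h2 h3 ih =>
    rw [prependWord_append]
    exact ih h2 (prependWord_mem_infTraces_of_step h3 (hv.resolve_left (Nat.succ_ne_zero _)) hw)

/-! ### Infinite paths as functions -/

variable (H) in
/-- `f` is an infinite path all of whose later nodes are concrete. -/
def InfPath (f : ℕ → H.W) : Prop :=
  (∀ i, H.Step (f i) (f (i + 1))) ∧ ∀ i, (f (i + 1)).isLeft = true

variable (H) in
/-- The color of a concrete node; abstract nodes have no color. -/
def nodeColor : H.W → Set C
  | Sum.inl v => H.color v
  -- A default that is irrelevant for infinite paths, whose later nodes are concrete.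
  | Sum.inr _ => ∅

variable (H) in
/-- The color word of an infinite path. -/
def infWord (f : ℕ → H.W) : ℕ → Set C :=
  prependWord (H.nodeWord (f 0)) fun i => H.nodeColor (f (i + 1))

variable (H) in
/-- The color word of the first `n` nodes of `f`. -/
def preWord (f : ℕ → H.W) : ℕ → List (Set C)
  | 0 => []
  | n + 1 => preWord f n ++ H.nodeWord (f n)

theorem InfPath.shift {f : ℕ → H.W} (h : H.InfPath f) (t : ℕ) :
    H.InfPath fun i => f (t + i) :=
  ⟨fun i => h.1 (t + i), fun i => h.2 (t + i)⟩

theorem mem_infTraces_iff {u : H.W} {w : ℕ → Set C} :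
    w ∈ H.infTraces u ↔ ∃ f, f 0 = u ∧ H.InfPath f ∧ w = H.infWord f := by
  constructor
  · rintro ⟨p, h0, hs, rfl⟩
    refine ⟨fun i => Nat.casesOn i u fun i => Sum.inl (p i), rfl, ⟨fun i => ?_, fun i => rfl⟩, rfl⟩
    cases i with
    | zero => exact h0
    | succ i => exact hs i
  · rintro ⟨f, rfl, ⟨hs, hc⟩, rfl⟩
    choose p hp using fun i => Sum.isLeft_iff.1 (hc i)
    refine ⟨p, ?_, fun i => ?_, ?_⟩
    · rw [← hp]
      exact hs 0
    · rw [← hp, ← hp]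
      exact hs (i + 1)
    · simp only [infWord, hp, nodeColor]

theorem InfPath.infWord_eq {f : ℕ → H.W} (h : H.InfPath f) (t : ℕ) :
    H.infWord f = prependWord (H.preWord f t) (H.infWord fun i => f (t + i)) := by
  induction t with
  | zero => simp [preWord, prependWord_nil]
  | succ t ih =>
    rw [ih, preWord, prependWord_append]
    congr 1
    change prependWord (H.nodeWord (f t)) _ = _
    congr 1
    -- Only the first node of an infinite path may be abstract, so the first node of the remaining
    -- path contributes exactly one letter.
    obtain ⟨y, hy⟩ := Sum.isLeft_iff.1 (h.2 t)
    have hw : H.nodeWord (f (t + 1)) = [H.color y] := by rw [hy]; rfl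
    funext i
    change H.nodeColor (f (t + (i + 1))) =
      prependWord (H.nodeWord (f (t + 1))) (fun i => H.nodeColor (f (t + 1 + (i + 1)))) i
    rw [hw]
    cases i with
    | zero =>
      rw [prependWord_getElem (l := [H.color y]) _ Nat.zero_lt_one, Nat.zero_add, hy]
      rfl
    | succ i =>
      rw [Nat.add_comm i 1]
      refine Eq.trans ?_ (prependWord_add [H.color y] _ i).symm
      congr 2
      omega

theorem InfPath.pt {f : ℕ → H.W} (h : H.InfPath f) (n : ℕ) :
    H.PT (f 0) n (H.preWord f n) (f n) := by
  induction n with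
  | zero => exact PT.nil
  | succ n ih =>
    refine ih.snoc ?_ (h.1 n)
    cases n with
    | zero => exact Or.inl rfl
    | succ n => exact Or.inr (h.2 n)

theorem preWord_congr {f g : ℕ → H.W} {n : ℕ} (h : ∀ i, i < n → f i = g i) :
    H.preWord f n = H.preWord g n := by
  induction n with
  | zero => rfl
  | succ n ih =>
    rw [preWord, preWord, ih fun i hi => h i (Nat.lt_succ_of_lt hi), h n (Nat.lt_succ_self n)]

theorem PT.exists_fun {u v : H.W} {n : ℕ} {a : List (Set C)} (h : H.PT u n a v) :
    ∃ f : ℕ → H.W, f 0 = u ∧ f n = v ∧ (∀ i, i < n → H.Step (f i) (f (i + 1))) ∧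
      (∀ i, 0 < i → i < n → (f i).isLeft = true) ∧ a = H.preWord f n := by
  induction h with
  | nil => exact ⟨fun _ => u, rfl, rfl, fun i hi => absurd hi (Nat.not_lt_zero i),
      fun i _ hi => absurd hi (Nat.not_lt_zero i), rfl⟩
  | @snoc n a x v h1 h2 h3 ih =>
    obtain ⟨f, hf0, hfn, hs, hc, rfl⟩ := ih
    have e : ∀ i, i ≤ n → Function.update f (n + 1) v i = f i := fun i hi =>
      Function.update_of_ne (by omega) _ _
    refine ⟨Function.update f (n + 1) v, by rw [e 0 (Nat.zero_le _), hf0],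
      Function.update_self _ _ _, fun i hi => ?_, fun i h0 hi => ?_, ?_⟩
    · rcases Nat.lt_or_eq_of_le (Nat.le_of_lt_succ hi) with h | rfl
      · rw [e i h.le, e (i + 1) h]
        exact hs i h
      · rw [e i le_rfl, Function.update_self, hfn]
        exact h3
    · rcases Nat.lt_or_eq_of_le (Nat.le_of_lt_succ hi) with h | rfl
      · rw [e i h.le]
        exact hc i h0 h
      · rw [e i le_rfl, hfn]
        exact h2.resolve_left h0.ne'
    · rw [preWord, e n le_rfl, hfn, preWord_congr fun i hi => e i hi.le]

/-- Here `w n` is the word of the glued path from junction `n` on, which is the factorization that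
`BuchiAutomaton.OmegaEquiv.of_blocks` expects. Junctions become later nodes of the path and must
therefore be concrete. -/
theorem exists_mem_infTraces_of_blocks {y : ℕ → H.W} {m : ℕ → ℕ} {a : ℕ → List (Set C)}
    (hm : ∀ n, 0 < m n) (hy : ∀ n, (y n).isLeft = true)
    (h : ∀ n, H.PT (y n) (m n) (a n) (y (n + 1))) :
    ∃ w : ℕ → ℕ → Set C, w 0 ∈ H.infTraces (y 0) ∧
      ∀ n, w n = prependWord (a n) (w (n + 1)) := by
  choose g hg0 hgm hs hc ha using fun n => (h n).exists_fun
  obtain ⟨f, hf⟩ := exists_glue hm g fun n => (hgm n).trans (hg0 (n + 1)).symm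
  have hp : H.InfPath f := by
    constructor
    · intro i
      obtain ⟨n, j, hj, rfl⟩ := exists_block hm i
      rw [hf n j hj.le, Nat.add_assoc, hf n (j + 1) hj]
      exact hs n j hj
    · intro i
      obtain ⟨n, j, hj, hi⟩ := exists_block hm (i + 1)
      rw [hi, hf n j hj.le]
      rcases Nat.eq_zero_or_pos j with rfl | h0
      · rw [hg0]
        exact hy n
      · exact hc n j h0 hj
  refine ⟨fun n => H.infWord fun i => f (blockStart m n + i),
    mem_infTraces_iff.2 ⟨fun i => f (0 + i), ?_, hp.shift 0, rfl⟩, fun n => ?_⟩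
  · exact (hf 0 0 (Nat.zero_le _)).trans (hg0 0)
  · refine ((hp.shift (blockStart m n)).infWord_eq (m n)).trans ?_
    rw [ha n, preWord_congr (g := g n) fun i hi => hf n i hi.le]
    simp only [blockStart, Nat.add_assoc]

end HG

namespace HG

variable {C : Type uC} {Act : Type uA} {L : Type uL} {H : HG C Act L} {K : H.E → HG C Act L}
  (hK : ∀ e, (K e).n = H.rank e)

/-! ### Nodes and paths of a replacement -/

/-- The nodes of `H` as nodes of the replacement. -/
def outerNode (x : H.W) : (H.repl K hK).W := H.outer K x

/-- The nodes of `K e` as nodes of the replacement. -/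
def innerNode (e : H.E) (x : (K e).W) : (H.repl K hK).W := H.inner K hK e x

theorem innerNode_inr (e : H.E) (i : Fin (K e).n) :
    innerNode hK e (Sum.inr i) = outerNode hK (H.att e (Fin.cast (hK e) i)) := rfl

theorem outerNode_injective : Function.Injective (outerNode hK) := by
  rintro (v | i) (w | j) h
  · exact congrArg Sum.inl (Sum.inl.inj (Sum.inl.inj h))
  · cases h
  · cases h
  · exact congrArg Sum.inr (Sum.inr.inj h)

theorem outerNode_ne_innerNode (x : H.W) (e : H.E) (v : (K e).V) :
    outerNode hK x ≠ innerNode hK e (Sum.inl v) := by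
  intro h
  rcases x with x | i <;> cases h

/-- Only concrete nodes of `K e` determine where they come from; an attached node may be shared by
several hyperedges or several positions of one hyperedge. -/
theorem innerNode_eq_inl {e e' : H.E} {x : (K e').W} {v : (K e).V}
    (h : innerNode hK e' x = innerNode hK e (Sum.inl v)) :
    (⟨e', x⟩ : Σ e, (K e).W) = ⟨e, Sum.inl v⟩ := by
  rcases x with x | i
  · have h : (⟨e', x⟩ : Σ e, (K e).V) = ⟨e, v⟩ := Sum.inr.inj (Sum.inl.inj h)
    cases h
    rfl
  · exact absurd h (outerNode_ne_innerNode hK _ e v)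

theorem node_cases (z : (H.repl K hK).W) :
    (∃ x, z = outerNode hK x) ∨ ∃ e v, z = innerNode hK e (Sum.inl v) := by
  rcases z with (v | ⟨e, v⟩) | i
  · exact Or.inl ⟨Sum.inl v, rfl⟩
  · exact Or.inr ⟨e, v, rfl⟩
  · exact Or.inl ⟨Sum.inr i, rfl⟩

theorem outerNode_isLeft (x : H.W) : (outerNode hK x).isLeft = x.isLeft := by
  cases x <;> rfl

theorem nodeWord_outerNode (x : H.W) :
    (H.repl K hK).nodeWord (outerNode hK x) = H.nodeWord x := by
  cases x <;> rfl

theorem repl_step_iff {x y : (H.repl K hK).W} :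
    (H.repl K hK).Step x y ↔
      (∃ a b, H.Step a b ∧ x = outerNode hK a ∧ y = outerNode hK b) ∨
        ∃ e a b, (K e).Step a b ∧ x = innerNode hK e a ∧ y = innerNode hK e b := by
  constructor
  · rintro ⟨t, ⟨a, s, b, h, he⟩ | ⟨e, a, s, b, h, he⟩⟩
    · exact Or.inl ⟨a, b, ⟨s, h⟩, congrArg (·.1) he, congrArg (·.2.2) he⟩
    · exact Or.inr ⟨e, a, b, ⟨s, h⟩, congrArg (·.1) he, congrArg (·.2.2) he⟩
  · rintro (⟨a, b, ⟨s, h⟩, rfl, rfl⟩ | ⟨e, a, b, ⟨s, h⟩, rfl, rfl⟩)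
    · exact ⟨s, Or.inl ⟨a, s, b, h, rfl⟩⟩
    · exact ⟨s, Or.inr ⟨e, a, s, b, h, rfl⟩⟩

theorem PT.outerNode {y z : H.W} {k : ℕ} {c : List (Set C)} (h : H.PT y k c z) :
    (H.repl K hK).PT (outerNode hK y) k c (outerNode hK z) := by
  induction h with
  | nil => exact PT.nil
  | snoc h1 h2 h3 ih =>
    rw [← nodeWord_outerNode hK]
    exact ih.snoc (by rwa [outerNode_isLeft]) ((repl_step_iff hK).2 (Or.inl ⟨_, _, h3, rfl, rfl⟩))

/-- The letter that a node of `K e` obtains by the replacement: abstract nodes of `K e` become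
attached nodes. -/
def addedWord (e : H.E) : (K e).W → List (Set C)
  | Sum.inl _ => []
  | Sum.inr i => (H.repl K hK).nodeWord (innerNode hK e (Sum.inr i))

theorem nodeWord_innerNode (e : H.E) (x : (K e).W) :
    (H.repl K hK).nodeWord (innerNode hK e x) = addedWord hK e x ++ (K e).nodeWord x := by
  rcases x with v | i
  · rfl
  · simp [addedWord, nodeWord]

/-- A path of length `0` has the empty word and would miss the letter that an abstract `s` obtains;
hence `0 < k`. -/
theorem PT.innerNode {e : H.E} {s b : (K e).W} {k : ℕ} {c : List (Set C)}
    (h : (K e).PT s k c b) (hk : 0 < k) :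
    (H.repl K hK).PT (innerNode hK e s) k (addedWord hK e s ++ c) (innerNode hK e b) := by
  induction h with
  | nil => exact absurd hk (lt_irrefl 0)
  | @snoc n a x v h1 h2 h3 ih =>
    have hst := (repl_step_iff hK).2 (Or.inr ⟨e, _, _, h3, rfl, rfl⟩)
    rcases Nat.eq_zero_or_pos n with rfl | hn
    · obtain ⟨rfl, rfl⟩ := h1.zero_inv
      have := PT.single hst
      rwa [nodeWord_innerNode] at this
    · obtain ⟨y, rfl⟩ := Sum.isLeft_iff.1 (h2.resolve_left hn.ne')
      rw [← List.append_assoc]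
      exact (ih hn).snoc (Or.inr rfl) hst

theorem infTraces_outerNode {y : H.W} {w : ℕ → Set C} (h : w ∈ H.infTraces y) :
    w ∈ (H.repl K hK).infTraces (outerNode hK y) := by
  obtain ⟨p, h0, hs, rfl⟩ := h
  refine ⟨fun i => Sum.inl (p i), (repl_step_iff hK).2 (Or.inl ⟨_, _, h0, rfl, rfl⟩),
    fun i => (repl_step_iff hK).2 (Or.inl ⟨_, _, hs i, rfl, rfl⟩), ?_⟩
  rw [nodeWord_outerNode]
  rfl

theorem infTraces_innerNode {e : H.E} {s : (K e).W} {w : ℕ → Set C}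
    (h : w ∈ (K e).infTraces s) :
    prependWord (addedWord hK e s) w ∈ (H.repl K hK).infTraces (innerNode hK e s) := by
  obtain ⟨p, h0, hs, rfl⟩ := h
  refine ⟨fun i => Sum.inr ⟨e, p i⟩, (repl_step_iff hK).2 (Or.inr ⟨e, _, _, h0, rfl, rfl⟩),
    fun i => (repl_step_iff hK).2 (Or.inr ⟨e, _, _, hs i, rfl, rfl⟩), ?_⟩
  rw [nodeWord_innerNode, prependWord_append]
  rfl

end HG

/-! ### One-sided simulations -/

/-- Every trace between nodes of `H` is `M`-equivalent to a trace between the nodes of `H'` that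
correspond to them under the functional relation `ρ`. -/
structure HalfSim {Q : Type uQ} {C : Type uC} {Act : Type uA} {L : Type uL}
    (M : BuchiAutomaton Q (Set C)) (H H' : HG C Act L) (ρ : H.W → H'.W → Prop) : Prop where
  func : ∀ {x y z}, ρ x y → ρ x z → y = z
  conc : ∀ {x y}, ρ x y → x.isLeft = y.isLeft
  word : ∀ {x y}, ρ x y → M.WordEquiv (H.nodeWord x) (H'.nodeWord y)
  fin : ∀ {x x' y y'}, ρ x x' → ρ y y' → ∀ w ∈ H.finTraces x y,
    ∃ w' ∈ H'.finTraces x' y', M.WordEquiv w w'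
  inf : ∀ {x x'}, ρ x x' → ∀ w ∈ H.infTraces x, ∃ w' ∈ H'.infTraces x', M.OmegaEquiv w w'

section

open HG

variable {Q : Type uQ} {C : Type uC} {Act : Type uA} {L : Type uL}
  {M : BuchiAutomaton Q (Set C)} {H H' : HG C Act L}

/-- Traces have at least one edge, so empty paths are matched separately through `func` and `word`.
The last letter stays in the equivalence because word equivalence does not cancel in general. -/
theorem HalfSim.pt {ρ : H.W → H'.W → Prop} (h : HalfSim M H H' ρ) {x x' y y'} (hx : ρ x x') (hy : ρ y y') {n : ℕ}
    {a : List (Set C)} (hp : H.PT x n a y) :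
    ∃ m b, (n = 0 ↔ m = 0) ∧ H'.PT x' m b y' ∧
      M.WordEquiv (a ++ H.nodeWord y) (b ++ H'.nodeWord y') := by
  rcases Nat.eq_zero_or_pos n with rfl | hn
  · obtain ⟨rfl, rfl⟩ := hp.zero_inv
    obtain rfl := h.func hx hy
    exact ⟨0, [], Iff.rfl, PT.nil, h.word hx⟩
  · obtain ⟨w', hw', he⟩ := h.fin hx hy _ (mem_finTraces_iff.2 ⟨n, a, hn, hp, rfl⟩)
    obtain ⟨m, b, hm, hp', rfl⟩ := mem_finTraces_iff.1 hw'
    exact ⟨m, b, by omega, hp', he⟩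

/-- Simulations between two hypergraphs and between the hypergraphs that replace their
hyperedges. -/
structure ReplSim (M : BuchiAutomaton Q (Set C)) (H H' : HG C Act L) (K : H.E → HG C Act L)
    (K' : H'.E → HG C Act L) (hK : ∀ e, (K e).n = H.rank e) (hK' : ∀ e, (K' e).n = H'.rank e)
    (ρ : H.W → H'.W → Prop) (ε : H.E → H'.E → Prop)
    (σ : ∀ e e', (K e).W → (K' e').W → Prop) : Prop where
  sim : HalfSim M H H' ρ
  edge : ∀ e, ∃ e', ε e e'
  edge_func : ∀ {e e' e''}, ε e e' → ε e e'' → e' = e''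
  n_eq : ∀ {e e'}, ε e e' → (K e).n = (K' e').n
  att : ∀ {e e'}, ε e e' → ∀ i i', i.val = i'.val →
    ρ (H.att e (Fin.cast (hK e) i)) (H'.att e' (Fin.cast (hK' e') i'))
  inner : ∀ {e e'}, ε e e' → HalfSim M (K e) (K' e') (σ e e')
  abs : ∀ {e e'}, ε e e' → ∀ i i', i.val = i'.val → σ e e' (Sum.inr i) (Sum.inr i')

variable {K : H.E → HG C Act L}
    {K' : H'.E → HG C Act L} {hK : ∀ e, (K e).n = H.rank e} {hK' : ∀ e, (K' e).n = H'.rank e}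
    {ρ : H.W → H'.W → Prop} {ε : H.E → H'.E → Prop}
    {σ : ∀ e e', (K e).W → (K' e').W → Prop}

variable (hK hK' ρ ε σ) in
/-- The relation on nodes of replacements induced by relations `ρ` on outer nodes and `σ` on inner
nodes. -/
def LiftRel (z : (H.repl K hK).W) (z' : (H'.repl K' hK').W) : Prop :=
  (∃ x x', ρ x x' ∧ z = outerNode hK x ∧ z' = outerNode hK' x') ∨
    ∃ e e' v v', ε e e' ∧ σ e e' (Sum.inl v) (Sum.inl v') ∧ z = innerNode hK e (Sum.inl v) ∧
      z' = innerNode hK' e' (Sum.inl v')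

theorem LiftRel.outer {x x'} (h : ρ x x') :
    LiftRel hK hK' ρ ε σ (outerNode hK x) (outerNode hK' x') :=
  Or.inl ⟨x, x', h, rfl, rfl⟩

theorem LiftRel.outer_inv {x z'}
    (h : LiftRel hK hK' ρ ε σ (outerNode hK x) z') : ∃ x', ρ x x' ∧ z' = outerNode hK' x' := by
  rcases h with ⟨y, y', h, e, e'⟩ | ⟨e, e', v, v', -, -, h, -⟩
  · obtain rfl := outerNode_injective hK e
    exact ⟨y', h, e'⟩
  · exact absurd h (outerNode_ne_innerNode hK _ _ _)

theorem LiftRel.inner_inv (S : ReplSim M H H' K K' hK hK' ρ ε σ) {e e' v z'} (he : ε e e')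
    (h : LiftRel hK hK' ρ ε σ (innerNode hK e (Sum.inl v)) z') :
    ∃ v', σ e e' (Sum.inl v) (Sum.inl v') ∧ z' = innerNode hK' e' (Sum.inl v') := by
  rcases h with ⟨y, y', h, e, -⟩ | ⟨e₁, e₁', v₁, v', h1, h2, h3, h4⟩
  · exact absurd e.symm (outerNode_ne_innerNode hK _ _ _)
  · cases innerNode_eq_inl hK h3
    obtain rfl := S.edge_func he h1
    exact ⟨v', h2, h4⟩

variable (M hK hK' ρ) in
/-- A path to the outer node `z` with word `a` splits into a part that is matched by a path from
`X'`, and a final part inside `H`. -/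
def OuterForm (X' : (H'.repl K' hK').W) (n : ℕ) (a : List (Set C)) (z : H.W) : Prop :=
  ∃ y y' m a₀ a₀' k c, ρ y y' ∧ (H'.repl K' hK').PT X' m a₀' (outerNode hK' y') ∧
    (k = 0 ∨ m = 0 ∨ y'.isLeft = true) ∧ M.WordEquiv a₀ a₀' ∧ H.PT y k c z ∧ a = a₀ ++ c ∧
    (n = 0 ↔ m = 0 ∧ k = 0)

variable (M hK hK' σ) in
/-- A path to the inner node `b` with word `a` splits into a part that is matched by a path from
`X'`, and a final part inside `K e`. -/
def InnerForm (X' : (H'.repl K' hK').W) (n : ℕ) (a : List (Set C)) (e : H.E) (e' : H'.E)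
    (b : (K e).W) : Prop :=
  ∃ s s' m a₀ a₀' k c, σ e e' s s' ∧ (H'.repl K' hK').PT X' m a₀' (innerNode hK' e' s') ∧
    (m = 0 ∨ (innerNode hK' e' s').isLeft = true) ∧
    M.WordEquiv a₀ (a₀' ++ addedWord hK' e' s') ∧ (K e).PT s k c b ∧ a = a₀ ++ c ∧
    (n = 0 ↔ k = 0)

variable (M hK hK' ρ ε σ) in
/-- A path to `Z` with word `a` splits as in `OuterForm` or `InnerForm`. -/
def PathForm (X' : (H'.repl K' hK').W) (n : ℕ) (a : List (Set C)) (Z : (H.repl K hK).W) : Prop :=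
  (∃ z, Z = outerNode hK z ∧ OuterForm M hK' ρ X' n a z) ∨
    ∃ e v e', Z = innerNode hK e (Sum.inl v) ∧ ε e e' ∧
      InnerForm M hK' σ X' n a e e' (Sum.inl v)

/-- Traces can be compared only between related nodes, while a path may stop at an unrelated one.
The final part `c` is therefore left pending and is exchanged as a whole once its end point has a
partner. -/
theorem OuterForm.match (S : ReplSim M H H' K K' hK hK' ρ ε σ) {X' : (H'.repl K' hK').W}
    {n : ℕ} {a : List (Set C)} {z : H.W} {z' : H'.W} (h : OuterForm M hK' ρ X' n a z)
    (hz : ρ z z') :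
    ∃ m a', (n = 0 ↔ m = 0) ∧ (H'.repl K' hK').PT X' m a' (outerNode hK' z') ∧
      M.WordEquiv (a ++ H.nodeWord z) (a' ++ H'.nodeWord z') := by
  obtain ⟨y, y', m, a₀, a₀', k, c, hy, hp, hm, ha, hk, rfl, hn⟩ := h
  obtain ⟨l, b, hl, hb, hbe⟩ := S.sim.pt hy hz hk
  by_cases h0 : k = 0
  · obtain rfl := hl.1 h0
    obtain rfl : k = 0 := h0
    obtain ⟨rfl, rfl⟩ := hb.zero_inv
    refine ⟨m, a₀', by simpa using hn, hp, ?_⟩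
    rw [List.append_assoc]
    exact ha.append M hbe
  · refine ⟨m + l, a₀' ++ b, by omega, hp.trans ?_ (hb.outerNode hK'), ?_⟩
    · rw [outerNode_isLeft]
      exact hm.resolve_left h0
    · rw [List.append_assoc, List.append_assoc]
      exact ha.append M hbe

theorem InnerForm.match (S : ReplSim M H H' K K' hK hK' ρ ε σ) {X' : (H'.repl K' hK').W}
    {n : ℕ} {a : List (Set C)} {e : H.E} {e' : H'.E} (he : ε e e') {b : (K e).W}
    {b' : (K' e').W} (h : InnerForm M hK' σ X' n a e e' b) (hn : 0 < n) (hb : σ e e' b b') :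
    ∃ m a', 0 < m ∧ (H'.repl K' hK').PT X' m a' (innerNode hK' e' b') ∧
      M.WordEquiv (a ++ (K e).nodeWord b) (a' ++ (K' e').nodeWord b') := by
  obtain ⟨s, s', m, a₀, a₀', k, c, hs, hp, hm, ha, hk, rfl, hnk⟩ := h
  obtain ⟨l, d, hl, hd, hde⟩ := (S.inner he).pt hs hb hk
  refine ⟨m + l, a₀' ++ (addedWord hK' e' s' ++ d), by omega,
    hp.trans hm (hd.innerNode hK' (by omega)), ?_⟩
  rw [List.append_assoc, ← List.append_assoc a₀', List.append_assoc]
  exact ha.append M hde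

/-- A concrete `s` means that the path is already inside `K e` and its pending part grows. An
abstract `s` means that the path enters `K e` at an attached node: the outer part is closed and a
new pending part of length one begins. -/
theorem PathForm.innerForm_of_step (S : ReplSim M H H' K K' hK hK' ρ ε σ)
    {X' : (H'.repl K' hK').W} {n : ℕ} {a : List (Set C)} {e : H.E} {s b : (K e).W}
    (h : PathForm M hK hK' ρ ε σ X' n a (innerNode hK e s))
    (hn : n = 0 ∨ (innerNode hK e s).isLeft = true) (hst : (K e).Step s b) :
    ∃ e', ε e e' ∧ InnerForm M hK' σ X' (n + 1)
      (a ++ (H.repl K hK).nodeWord (innerNode hK e s)) e e' b := by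
  rcases s with v | i
  · rcases h with ⟨z, hz, -⟩ | ⟨e₁, v₁, e', hz, he, h⟩
    · exact absurd hz.symm (outerNode_ne_innerNode hK _ _ _)
    · cases innerNode_eq_inl hK hz
      obtain ⟨s, s', m, a₀, a₀', k, c, hs, hp, hm, ha, hk, rfl, hnk⟩ := h
      exact ⟨e', he, s, s', m, a₀, a₀', k + 1, c ++ (K e).nodeWord (Sum.inl v), hs, hp, hm, ha,
        hk.snoc (Or.inr rfl) hst, List.append_assoc _ _ _, by omega⟩
  · rcases h with ⟨z, hz, h⟩ | ⟨e₁, v₁, e', hz, -⟩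
    · obtain ⟨e', he⟩ := S.edge e
      rw [innerNode_inr] at hz hn ⊢
      obtain rfl := outerNode_injective hK hz
      have hatt := S.att he i (Fin.cast (S.n_eq he) i) rfl
      obtain ⟨m, a', hm, hp, ha⟩ := h.match S hatt
      -- The letter of the attached node is counted in the matched part, as `addedWord`; inside `K
      -- e` the node is abstract and the pending word is empty.
      refine ⟨e', he, Sum.inr i, Sum.inr (Fin.cast (S.n_eq he) i), m, _, a', 1, [],
        S.abs he _ _ rfl, hp, ?_, ?_, PT.single hst, (List.append_nil _).symm, by omega⟩
      · rw [innerNode_inr, outerNode_isLeft, ← S.sim.conc hatt]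
        rw [outerNode_isLeft] at hn
        exact hn.imp_left hm.1
      · rw [addedWord, innerNode_inr, nodeWord_outerNode, nodeWord_outerNode]
        exact ha
    · exact absurd hz (outerNode_ne_innerNode hK _ _ _)

/-- Induction on the path, deciding for each step whether it comes from `H` or from some `K e`. Only
entering or leaving a `K e` closes a pending part, and this happens at attached nodes, which have
partners. -/
theorem PathForm.of_pt (S : ReplSim M H H' K K' hK hK' ρ ε σ) {X : (H.repl K hK).W}
    {X' : (H'.repl K' hK').W} (hX : LiftRel hK hK' ρ ε σ X X') {n : ℕ} {a : List (Set C)}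
    {Z : (H.repl K hK).W} (h : (H.repl K hK).PT X n a Z) :
    PathForm M hK hK' ρ ε σ X' n a Z := by
  induction h with
  | nil =>
    rcases hX with ⟨x, x', h, rfl, rfl⟩ | ⟨e, e', v, v', he, h, rfl, rfl⟩
    · exact Or.inl ⟨x, rfl, x, x', 0, [], [], 0, [], h, PT.nil, Or.inl rfl,
        BuchiAutomaton.WordEquiv.refl M _, PT.nil, rfl, by simp⟩
    · exact Or.inr ⟨e, v, e', rfl, he, Sum.inl v, Sum.inl v', 0, [], [], 0, [], h, PT.nil,
        Or.inl rfl, BuchiAutomaton.WordEquiv.refl M _, PT.nil, rfl, by simp⟩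
  | @snoc n a Z V h1 h2 h3 ih =>
    rcases (repl_step_iff hK).1 h3 with ⟨x, y, hst, rfl, rfl⟩ | ⟨e, s, b, hst, rfl, rfl⟩
    · rcases ih with ⟨z, hz, h⟩ | ⟨e₁, v₁, e', hz, -⟩
      · obtain rfl := outerNode_injective hK hz
        obtain ⟨y₀, y', m, a₀, a₀', k, c, hy, hp, hm, ha, hk, rfl, hn⟩ := h
        rw [outerNode_isLeft] at h2
        refine Or.inl ⟨y, rfl, y₀, y', m, a₀, a₀', k + 1, c ++ H.nodeWord x, hy, hp, Or.inr ?_, ha,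
          hk.snoc (h2.imp_left fun h => (hn.1 h).2) hst, ?_, by simp⟩
        -- If the pending part was empty, `y₀` is the current node, which is concrete unless the
        -- whole path is empty; `ρ` carries this over to `y'`.
        · rcases hm with rfl | hm
          · obtain ⟨rfl, -⟩ := hk.zero_inv
            rw [← S.sim.conc hy]
            exact h2.imp_left fun h => (hn.1 h).1
          · exact hm
        · rw [nodeWord_outerNode, List.append_assoc]
      · exact absurd hz (outerNode_ne_innerNode hK _ _ _)
    · obtain ⟨e', he, h⟩ := ih.innerForm_of_step S h2 hst
      rcases b with v | j
      · exact Or.inr ⟨e, v, e', rfl, he, h⟩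
      -- The path leaves `K e`. Its end point is abstract in `K e` and has no letter there, so the
      -- word is matched exactly up to, but excluding, the attached node.
      · obtain ⟨m, a', hm, hp, ha⟩ := h.match S he (Nat.succ_pos _)
          (S.abs he j (Fin.cast (S.n_eq he) j) rfl)
        refine Or.inl ⟨_, innerNode_inr hK e j, _, _, m, _, a', 0, [],
          S.att he j (Fin.cast (S.n_eq he) j) rfl, hp, Or.inl rfl, ?_, PT.nil,
          (List.append_nil _).symm, by omega⟩
        simpa [nodeWord] using ha

variable (hK) in
/-- A path that leaves some `K e` for an outer node is matched without the letter of that node. -/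
theorem ReplSim.arrival (S : ReplSim M H H' K K' hK hK' ρ ε σ) {X : (H.repl K hK).W}
    {X' : (H'.repl K' hK').W} (hX : LiftRel hK hK' ρ ε σ X X') {n : ℕ} {a : List (Set C)}
    {e : H.E} {s : (K e).W} {j : Fin (K e).n} (h : (H.repl K hK).PT X n a (innerNode hK e s))
    (hn : n = 0 ∨ (innerNode hK e s).isLeft = true) (hst : (K e).Step s (Sum.inr j)) {y' : H'.W}
    (hy : ρ (H.att e (Fin.cast (hK e) j)) y') :
    ∃ m a', 0 < m ∧ (H'.repl K' hK').PT X' m a' (outerNode hK' y') ∧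
      M.WordEquiv (a ++ (H.repl K hK).nodeWord (innerNode hK e s)) a' := by
  obtain ⟨e', he, h⟩ := (PathForm.of_pt S hX h).innerForm_of_step S hn hst
  obtain ⟨m, a', hm, hp, ha⟩ := h.match S he (Nat.succ_pos _)
    (S.abs he j (Fin.cast (S.n_eq he) j) rfl)
  obtain rfl := S.sim.func (S.att he j (Fin.cast (S.n_eq he) j) rfl) hy
  exact ⟨m, a', hm, hp, by simpa [nodeWord] using ha⟩

theorem ReplSim.fin (S : ReplSim M H H' K K' hK hK' ρ ε σ) {X Y : (H.repl K hK).W}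
    {X' Y' : (H'.repl K' hK').W} (hX : LiftRel hK hK' ρ ε σ X X')
    (hY : LiftRel hK hK' ρ ε σ Y Y') (w) (hw : w ∈ (H.repl K hK).finTraces X Y) :
    ∃ w' ∈ (H'.repl K' hK').finTraces X' Y', M.WordEquiv w w' := by
  obtain ⟨n, a, hn, hp, rfl⟩ := mem_finTraces_iff.1 hw
  rcases PathForm.of_pt S hX hp with ⟨z, rfl, h⟩ | ⟨e, v, e', rfl, he, h⟩
  · obtain ⟨z', hz, rfl⟩ := hY.outer_inv
    obtain ⟨m, a', hm, hp', ha⟩ := h.match S hz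
    refine ⟨_, mem_finTraces_iff.2 ⟨m, a', by omega, hp', rfl⟩, ?_⟩
    rwa [nodeWord_outerNode, nodeWord_outerNode]
  · obtain ⟨v', hv, rfl⟩ := hY.inner_inv S he
    obtain ⟨m, a', hm, hp', ha⟩ := h.match S he hn hv
    exact ⟨_, mem_finTraces_iff.2 ⟨m, a', hm, hp', rfl⟩, ha⟩

end

/-! ### Infinite traces of a replacement -/

section

open HG

variable {Q : Type uQ} {C : Type uC} {Act : Type uA} {L : Type uL}
  {M : BuchiAutomaton Q (Set C)} {H H' : HG C Act L} {K : H.E → HG C Act L}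
    {K' : H'.E → HG C Act L} {hK : ∀ e, (K e).n = H.rank e} {hK' : ∀ e, (K' e).n = H'.rank e}
    {ρ : H.W → H'.W → Prop} {ε : H.E → H'.E → Prop}
    {σ : ∀ e e', (K e).W → (K' e').W → Prop}

variable (hK) in
/-- The step `i` of the path `f` leads from `K e` to an outer node. -/
def ArrivesAt (f : ℕ → (H.repl K hK).W) (i : ℕ) : Prop :=
  ∃ e s j, (K e).Step s (Sum.inr j) ∧ f i = innerNode hK e s ∧
    f (i + 1) = innerNode hK e (Sum.inr j)

/-- The pending part and the infinite tail together form one infinite trace of `H` from `y`, to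
which the simulation applies directly. -/
theorem OuterForm.exists_infTrace [Finite Q] (S : ReplSim M H H' K K' hK hK' ρ ε σ)
    {X' : (H'.repl K' hK').W} {n : ℕ} {a : List (Set C)} {z : H.W}
    (h : OuterForm M hK' ρ X' n a z) (hz : z.isLeft = true) {w : ℕ → Set C}
    (hw : w ∈ H.infTraces z) :
    ∃ w' ∈ (H'.repl K' hK').infTraces X', M.OmegaEquiv (prependWord a w) w' := by
  obtain ⟨y, y', m, a₀, a₀', k, c, hy, hp, hm, ha, hk, rfl, hn⟩ := h
  obtain ⟨w', hw', he⟩ := S.sim.inf hy _ (hk.prependWord_mem_infTraces (Or.inr hz) hw)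
  refine ⟨prependWord a₀' w', hp.prependWord_mem_infTraces ?_ (infTraces_outerNode hK' hw'), ?_⟩
  · rw [outerNode_isLeft]
    rcases hm with rfl | hm
    · obtain ⟨rfl, -⟩ := hk.zero_inv
      exact Or.inr (S.sim.conc hy ▸ hz)
    · exact hm
  · rw [prependWord_append]
    exact BuchiAutomaton.OmegaEquiv.prependWord M ha he

theorem InnerForm.exists_infTrace [Finite Q] (S : ReplSim M H H' K K' hK hK' ρ ε σ)
    {X' : (H'.repl K' hK').W} {n : ℕ} {a : List (Set C)} {e : H.E} {e' : H'.E} (hε : ε e e')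
    {v : (K e).V} (h : InnerForm M hK' σ X' n a e e' (Sum.inl v)) {w : ℕ → Set C}
    (hw : w ∈ (K e).infTraces (Sum.inl v)) :
    ∃ w' ∈ (H'.repl K' hK').infTraces X', M.OmegaEquiv (prependWord a w) w' := by
  obtain ⟨s, s', m, a₀, a₀', k, c, hs, hp, hm, ha, hk, rfl, hn⟩ := h
  obtain ⟨w', hw', he⟩ := (S.inner hε).inf hs _ (hk.prependWord_mem_infTraces (Or.inr rfl) hw)
  refine ⟨_, hp.prependWord_mem_infTraces hm (infTraces_innerNode hK' hw'), ?_⟩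
  rw [prependWord_append, ← prependWord_append a₀']
  exact BuchiAutomaton.OmegaEquiv.prependWord M ha he

/-- A step of some `K e` that ends in an outer node is an arrival, so without arrivals all steps
between outer nodes come from `H`. -/
theorem outer_infTrace_of_not_arrivesAt {f : ℕ → (H.repl K hK).W} (hf : (H.repl K hK).InfPath f)
    (hA : ∀ i, ¬ ArrivesAt hK f i) (ho : ∀ i, ∃ x, f i = outerNode hK x) :
    ∃ x, f 0 = outerNode hK x ∧ (H.repl K hK).infWord f ∈ H.infTraces x := by
  choose g hg using ho
  refine ⟨g 0, hg 0, mem_infTraces_iff.2 ⟨g, rfl, ⟨fun i => ?_, fun i => ?_⟩, ?_⟩⟩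
  · rcases (repl_step_iff hK).1 (hf.1 i) with ⟨a, b, h, h1, h2⟩ | ⟨e, s, b, h, h1, h2⟩
    · rw [hg] at h1 h2
      rwa [outerNode_injective hK h1, outerNode_injective hK h2]
    · rcases b with v | j
      · rw [hg] at h2
        exact absurd h2 (outerNode_ne_innerNode hK _ _ _)
      · exact absurd ⟨e, s, j, h, h1, h2⟩ (hA i)
  · rw [← outerNode_isLeft hK, ← hg]
    exact hf.2 i
  · rw [infWord, infWord, hg 0, nodeWord_outerNode]
    congr 1
    funext i
    rw [hg (i + 1)]
    cases g (i + 1) <;> rfl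

/-- A concrete node of `K e` has outgoing edges from `K e` only, and the only way out of `K e` is an
arrival. -/
theorem inner_infTrace_of_not_arrivesAt {f : ℕ → (H.repl K hK).W} (hf : (H.repl K hK).InfPath f)
    (hA : ∀ i, ¬ ArrivesAt hK f i) {e : H.E} {v : (K e).V} (h0 : f 0 = innerNode hK e (Sum.inl v)) :
    (H.repl K hK).infWord f ∈ (K e).infTraces (Sum.inl v) := by
  have step : ∀ i u, f i = innerNode hK e (Sum.inl u) →
      ∃ u', (K e).Step (Sum.inl u) (Sum.inl u') ∧ f (i + 1) = innerNode hK e (Sum.inl u') := by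
    intro i u hu
    rcases (repl_step_iff hK).1 (hf.1 i) with ⟨a, b, h, h1, h2⟩ | ⟨e', s, b, h, h1, h2⟩
    · exact absurd (h1.symm.trans hu) (outerNode_ne_innerNode hK _ _ _)
    · rcases b with v | j
      · cases innerNode_eq_inl hK (h1.symm.trans hu)
        exact ⟨v, h, h2⟩
      · exact absurd ⟨e', s, j, h, h1, h2⟩ (hA i)
  have all : ∀ i, ∃ u, f i = innerNode hK e (Sum.inl u) := by
    intro i
    induction i with
    | zero => exact ⟨v, h0⟩
    | succ i ih =>
      obtain ⟨u, hu⟩ := ih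
      obtain ⟨u', -, hu'⟩ := step i u hu
      exact ⟨u', hu'⟩
  have inj : ∀ {u u' : (K e).V}, innerNode hK e (Sum.inl u) = innerNode hK e (Sum.inl u') →
      u = u' := by
    intro u u' h
    cases innerNode_eq_inl hK h
    rfl
  choose g hg using all
  obtain rfl : g 0 = v := inj ((hg 0).symm.trans h0)
  refine mem_infTraces_iff.2 ⟨fun i => Sum.inl (g i), rfl, ⟨fun i => ?_, fun i => rfl⟩, ?_⟩
  · obtain ⟨u', h1, h2⟩ := step i (g i) (hg i)
    rwa [← inj ((hg (i + 1)).symm.trans h2)] at h1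
  · rw [infWord, infWord, hg 0]
    congr 1
    funext i
    rw [hg (i + 1)]
    rfl

theorem ReplSim.inf_of_finite_arrivals [Finite Q] (S : ReplSim M H H' K K' hK hK' ρ ε σ)
    {X' : (H'.repl K' hK').W} {f : ℕ → (H.repl K hK).W} (hf : (H.repl K hK).InfPath f)
    (hX : LiftRel hK hK' ρ ε σ (f 0) X') (T : ℕ) (hT : ∀ i, T ≤ i → ¬ ArrivesAt hK f i) :
    ∃ w' ∈ (H'.repl K' hK').infTraces X', M.OmegaEquiv ((H.repl K hK).infWord f) w' := by
  -- The offset `1` ensures that the tail starts at a concrete node. Without arrivals, a single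
  -- inner node on the tail confines the path to its `K e` from there on.
  by_cases ho : ∀ i, ∃ x, f (T + 1 + i) = outerNode hK x
  · obtain ⟨x, hx, hw⟩ := outer_infTrace_of_not_arrivesAt (hf.shift (T + 1))
      (fun i => hT (T + 1 + i) (by omega)) ho
    rw [hf.infWord_eq (T + 1)]
    have hp := hf.pt (T + 1)
    have hl := hf.2 T
    change f (T + 1) = _ at hx
    rw [hx] at hp hl
    rcases PathForm.of_pt S hX hp with ⟨z, hz, h⟩ | ⟨e, v, e', hz, -⟩
    · obtain rfl := outerNode_injective hK hz
      exact h.exists_infTrace S (by rwa [outerNode_isLeft] at hl) hw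
    · exact absurd hz (outerNode_ne_innerNode hK _ _ _)
  · push Not at ho
    obtain ⟨i, hi⟩ := ho
    rcases node_cases hK (f (T + 1 + i)) with ⟨x, hx⟩ | ⟨e, v, hv⟩
    · exact absurd hx (hi x)
    · have hw := inner_infTrace_of_not_arrivesAt (hf.shift (T + 1 + i))
        (fun j => hT (T + 1 + i + j) (by omega)) hv
      rw [hf.infWord_eq (T + 1 + i)]
      have hp := hf.pt (T + 1 + i)
      rw [hv] at hp
      rcases PathForm.of_pt S hX hp with ⟨z, hz, h⟩ | ⟨e₁, v₁, e', hz, he, h⟩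
      · exact absurd hz.symm (outerNode_ne_innerNode hK _ _ _)
      · cases innerNode_eq_inl hK hz
        exact h.exists_infTrace S he hw

theorem ReplSim.exists_rel_of_arrivesAt (S : ReplSim M H H' K K' hK hK' ρ ε σ)
    {f : ℕ → (H.repl K hK).W} {i : ℕ} (h : ArrivesAt hK f i) :
    ∃ y y', f (i + 1) = outerNode hK y ∧ ρ y y' := by
  obtain ⟨e, s, j, -, -, h⟩ := h
  obtain ⟨e', he⟩ := S.edge e
  exact ⟨_, _, h, S.att he j (Fin.cast (S.n_eq he) j) rfl⟩

/-- Paths that end with the arrival at an outer node are matched without the last letter. -/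
theorem ReplSim.match_of_arrivesAt (S : ReplSim M H H' K K' hK hK' ρ ε σ)
    {X' : (H'.repl K' hK').W} {f : ℕ → (H.repl K hK).W} (hf : (H.repl K hK).InfPath f)
    (hX : LiftRel hK hK' ρ ε σ (f 0) X') {n : ℕ} (hA : ArrivesAt hK f n) {y : H.W} {y' : H'.W}
    (hy : f (n + 1) = outerNode hK y) (hyy : ρ y y') :
    ∃ m a', 0 < m ∧ (H'.repl K' hK').PT X' m a' (outerNode hK' y') ∧
      M.WordEquiv ((H.repl K hK).preWord f (n + 1)) a' := by
  obtain ⟨e, s, j, hst, h1, h2⟩ := hA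
  have hp := hf.pt n
  rw [hy, innerNode_inr] at h2
  obtain rfl := outerNode_injective hK h2
  rw [h1] at hp
  have hn : n = 0 ∨ (innerNode hK e s).isLeft = true := by
    rw [← h1]
    cases n with
    | zero => exact Or.inl rfl
    | succ n => exact Or.inr (hf.2 n)
  have := S.arrival hK hX hp hn hst hyy
  rwa [← h1] at this

/-- Cutting right before the letter of an arrival node is what makes the blocks composable: by
`ReplSim.arrival` each block is equivalent to its match without a shared last letter. -/
theorem ReplSim.inf_of_infinite_arrivals [Finite Q] (S : ReplSim M H H' K K' hK hK' ρ ε σ)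
    {X' : (H'.repl K' hK').W} {f : ℕ → (H.repl K hK).W} (hf : (H.repl K hK).InfPath f)
    (hX : LiftRel hK hK' ρ ε σ (f 0) X') (hT : ∀ T, ∃ i, T ≤ i ∧ ArrivesAt hK f i) :
    ∃ w' ∈ (H'.repl K' hK').infTraces X', M.OmegaEquiv ((H.repl K hK).infWord f) w' := by
  choose g hg hA using hT
  -- `s n` is the position just after the `n`-th chosen arrival step; the block from `s n` has `k n
  -- + 1` steps.
  let s : ℕ → ℕ := fun n => Nat.rec (g 0 + 1) (fun _ t => g t + 1) n
  have hs : ∀ n, ∃ k, s (n + 1) = s n + (k + 1) ∧ ArrivesAt hK f (s n + k) := by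
    intro n
    have h1 := hg (s n)
    refine ⟨g (s n) - s n, ?_, ?_⟩
    · change g (s n) + 1 = _
      omega
    · rw [Nat.add_sub_cancel' h1]
      exact hA _
  have harr : ∀ n, ∃ i, s n = i + 1 ∧ ArrivesAt hK f i := by
    intro n
    cases n with
    | zero => exact ⟨g 0, rfl, hA 0⟩
    | succ n => exact ⟨g (s n), rfl, hA _⟩
  have hy : ∀ n, ∃ y y', f (s n) = outerNode hK y ∧ ρ y y' ∧ y'.isLeft = true := by
    intro n
    obtain ⟨i, hi, hai⟩ := harr n
    obtain ⟨y, y', h1, h2⟩ := S.exists_rel_of_arrivesAt hai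
    refine ⟨y, y', hi ▸ h1, h2, ?_⟩
    rw [← S.sim.conc h2, ← outerNode_isLeft hK, ← h1]
    exact hf.2 i
  -- Partners are fixed once for all junctions, so that consecutive matched blocks meet.
  choose y y' hfy hyy hyl using hy
  choose k hk hak using hs
  obtain ⟨m₀, a₀', hm₀, hp₀, ha₀⟩ := S.match_of_arrivesAt hf hX (hA 0) (hfy 0) (hyy 0)
  have hseg := fun n => S.match_of_arrivesAt (X' := outerNode hK' (y' n)) (n := k n)
    (y := y (n + 1)) (y' := y' (n + 1)) (hf.shift (s n))
    (by
      change LiftRel hK hK' ρ ε σ (f (s n)) _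
      rw [hfy n]
      exact LiftRel.outer (hyy n))
    (hak n)
    (by
      rw [← hk n]
      exact hfy (n + 1))
    (hyy (n + 1))
  choose m a' hm hp ha using hseg
  obtain ⟨w', hw', hw'n⟩ := exists_mem_infTraces_of_blocks (y := fun n => outerNode hK' (y' n)) hm
    (fun n => by rw [outerNode_isLeft]; exact hyl n) hp
  have hleft : ∀ n, (f (s n)).isLeft = true := fun n => by
    obtain ⟨i, hi, -⟩ := harr n
    rw [hi]
    exact hf.2 i
  refine ⟨_, hp₀.prependWord_mem_infTraces (Or.inr ?_) hw', ?_⟩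
  · rw [outerNode_isLeft]
    exact hyl 0
  · rw [hf.infWord_eq (s 0)]
    refine BuchiAutomaton.OmegaEquiv.prependWord M ha₀ ?_
    refine BuchiAutomaton.OmegaEquiv.of_blocks M
      (w := fun n => (H.repl K hK).infWord fun i => f (s n + i))
      (a := fun n => (H.repl K hK).preWord (fun i => f (s n + i)) (k n + 1))
      (fun n => ?_) hw'n (fun n => ?_) (fun n => ?_) ha
    · refine ((hf.shift (s n)).infWord_eq (k n + 1)).trans ?_
      simp only [hk n, Nat.add_assoc]
    · exact ((hf.shift (s n)).pt (k n + 1)).ne_nil (Nat.succ_pos _) (hleft n)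
    · exact (hp n).ne_nil (hm n) (by rw [outerNode_isLeft]; exact hyl n)

theorem ReplSim.halfSim [Finite Q] (S : ReplSim M H H' K K' hK hK' ρ ε σ) :
    HalfSim M (H.repl K hK) (H'.repl K' hK') (LiftRel hK hK' ρ ε σ) where
  func {x y z} h h' := by
    rcases h with ⟨a, a', h1, rfl, rfl⟩ | ⟨e, e', v, v', he, h1, rfl, rfl⟩
    · obtain ⟨b, h2, rfl⟩ := h'.outer_inv
      rw [S.sim.func h1 h2]
    · obtain ⟨u, h2, rfl⟩ := h'.inner_inv S he
      rw [(S.inner he).func h1 h2]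
  conc {x y} h := by
    rcases h with ⟨a, a', h1, rfl, rfl⟩ | ⟨e, e', v, v', he, h1, rfl, rfl⟩
    · rw [outerNode_isLeft, outerNode_isLeft, S.sim.conc h1]
    · rfl
  word {x y} h := by
    rcases h with ⟨a, a', h1, rfl, rfl⟩ | ⟨e, e', v, v', he, h1, rfl, rfl⟩
    · rw [nodeWord_outerNode, nodeWord_outerNode]
      exact S.sim.word h1
    · exact (S.inner he).word h1
  fin h h' w hw := S.fin h h' w hw
  inf {x x'} h w hw := by
    obtain ⟨f, rfl, hf, rfl⟩ := mem_infTraces_iff.1 hw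
    by_cases hT : ∀ T, ∃ i, T ≤ i ∧ ArrivesAt hK f i
    · exact S.inf_of_infinite_arrivals hf h hT
    · push Not at hT
      obtain ⟨T, hT⟩ := hT
      exact S.inf_of_finite_arrivals hf h T hT

end

/-! ### Equivalence of views expressed by relations -/

theorem exists_equiv_of_rel {α β : Type*} {r : α → β → Prop} (h1 : ∀ a, ∃ b, r a b)
    (h2 : ∀ b, ∃ a, r a b) (f1 : ∀ {a b b'}, r a b → r a b' → b = b')
    (f2 : ∀ {a a' b}, r a b → r a' b → a = a') : ∃ e : α ≃ β, ∀ a, r a (e a) := by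
  choose f hf using h1
  choose g hg using h2
  exact ⟨⟨f, g, fun a => f2 (hg (f a)) (hf a), fun b => f1 (hf (g b)) (hg b)⟩, hf⟩

/-- One half of an `M`-equivalence of views, given by relations on nodes and on hyperedges. -/
structure HalfEquiv {Q : Type uQ} {C : Type uC} {Act : Type uA} {L : Type uL}
    (M : BuchiAutomaton Q (Set C)) (𝓥 𝓥' : HGV C Act L) (ρ : 𝓥.H.W → 𝓥'.H.W → Prop)
    (ε : 𝓥.H.E → 𝓥'.H.E → Prop) : Prop where
  sim : HalfSim M 𝓥.H 𝓥'.H ρ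
  n_eq : 𝓥.H.n = 𝓥'.H.n
  abs : ∀ i i', i.val = i'.val → ρ (Sum.inr i) (Sum.inr i')
  view : ∀ v ∈ 𝓥.U, ∃ v' ∈ 𝓥'.U, ρ (Sum.inl v) (Sum.inl v')
  edge : ∀ e, ∃ e', ε e e'
  edge_func : ∀ {e e' e''}, ε e e' → ε e e'' → e' = e''
  rank_eq : ∀ {e e'}, ε e e' → 𝓥.H.rank e = 𝓥'.H.rank e'
  att : ∀ {e e'}, ε e e' → ∀ i i', i.val = i'.val → ρ (𝓥.H.att e i) (𝓥'.H.att e' i')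

/-- An `M`-equivalence of views, given by relations on nodes and on hyperedges. In contrast to the
bijections of a coupling, the relation on nodes may also relate nodes that are not exposed. -/
def RelEquiv {Q : Type uQ} {C : Type uC} {Act : Type uA} {L : Type uL}
    (M : BuchiAutomaton Q (Set C)) (𝓥 𝓥' : HGV C Act L) (ρ : 𝓥.H.W → 𝓥'.H.W → Prop)
    (ε : 𝓥.H.E → 𝓥'.H.E → Prop) : Prop :=
  HalfEquiv M 𝓥 𝓥' ρ ε ∧ HalfEquiv M 𝓥' 𝓥 (flip ρ) (flip ε)

section

open HG

variable {Q : Type uQ} {C : Type uC} {Act : Type uA} {L : Type uL}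
  {M : BuchiAutomaton Q (Set C)} {𝓥 𝓥' : HGV C Act L}

theorem HalfEquiv.refl (𝓥 : HGV C Act L) : HalfEquiv M 𝓥 𝓥 Eq Eq where
  sim :=
    { func := fun h h' => h.symm.trans h'
      conc := fun h => h ▸ rfl
      word := fun {x y} h => by
        subst h
        exact BuchiAutomaton.WordEquiv.refl M _
      fin := fun {x x' y y'} h h' w hw => by
        subst h h'
        exact ⟨w, hw, BuchiAutomaton.WordEquiv.refl M w⟩
      inf := fun {x x'} h w hw => by
        subst h
        exact ⟨w, hw, fun _ => Iff.rfl⟩ }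
  n_eq := rfl
  abs i i' h := congrArg Sum.inr (Fin.ext h)
  view v hv := ⟨v, hv, rfl⟩
  edge e := ⟨e, rfl⟩
  edge_func h h' := h.symm.trans h'
  rank_eq h := h ▸ rfl
  att {e e'} h i i' hi := HGV.Coupling.att_congr 𝓥 h i i' hi

theorem RelEquiv.refl (𝓥 : HGV C Act L) : RelEquiv M 𝓥 𝓥 Eq Eq := by
  have h : (flip Eq : 𝓥.H.W → 𝓥.H.W → Prop) = Eq := by
    funext a b
    exact propext eq_comm
  have h' : (flip Eq : 𝓥.H.E → 𝓥.H.E → Prop) = Eq := by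
    funext a b
    exact propext eq_comm
  refine ⟨HalfEquiv.refl 𝓥, ?_⟩
  rw [h, h']
  exact HalfEquiv.refl 𝓥

theorem HalfEquiv.exists_rel {ρ : 𝓥.H.W → 𝓥'.H.W → Prop} {ε : 𝓥.H.E → 𝓥'.H.E → Prop}
    (h : HalfEquiv M 𝓥 𝓥' ρ ε) {x : 𝓥.H.W} (hx : x ∈ 𝓥.X) : ∃ x' ∈ 𝓥'.X, ρ x x' := by
  rcases x with v | i
  · rcases hx v rfl with hv | hv
    · obtain ⟨v', hv', hr⟩ := h.view v hv
      exact ⟨_, 𝓥'.view_mem_X ⟨v', hv'⟩, hr⟩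
    · simp only [HG.UA, mem_ofPred_eq, not_forall, not_not] at hv
      obtain ⟨e, i, hi⟩ := hv
      obtain ⟨e', he⟩ := h.edge e
      rw [← hi]
      exact ⟨_, 𝓥'.att_mem_X e' (Fin.cast (h.rank_eq he) i), h.att he _ _ rfl⟩
  · exact ⟨_, 𝓥'.abs_mem_X (Fin.cast h.n_eq i), h.abs _ _ rfl⟩

theorem RelEquiv.mequiv {ρ : 𝓥.H.W → 𝓥'.H.W → Prop} {ε : 𝓥.H.E → 𝓥'.H.E → Prop}
    (h : RelEquiv M 𝓥 𝓥' ρ ε) : M.MEquiv 𝓥 𝓥' := by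
  obtain ⟨h1, h2⟩ := h
  have f2 : ∀ {a a' b}, ρ a b → ρ a' b → a = a' := fun h h' => h2.sim.func h h'
  obtain ⟨ν, hν⟩ := exists_equiv_of_rel (r := fun (x : 𝓥.X) (x' : 𝓥'.X) => ρ x.1 x'.1)
    (fun x => by
      obtain ⟨x', hx', hr⟩ := h1.exists_rel x.2
      exact ⟨⟨x', hx'⟩, hr⟩)
    (fun x' => by
      obtain ⟨x, hx, hr⟩ := h2.exists_rel x'.2
      exact ⟨⟨x, hx⟩, hr⟩)
    (fun h h' => Subtype.ext (h1.sim.func h h')) (fun h h' => Subtype.ext (f2 h h'))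
  obtain ⟨η, hη⟩ := exists_equiv_of_rel
    (r := fun (v : 𝓥.U) (v' : 𝓥'.U) => ρ (Sum.inl v.1) (Sum.inl v'.1))
    (fun v => by
      obtain ⟨v', hv', hr⟩ := h1.view v.1 v.2
      exact ⟨⟨v', hv'⟩, hr⟩)
    (fun v' => by
      obtain ⟨v, hv, hr⟩ := h2.view v'.1 v'.2
      exact ⟨⟨v, hv⟩, hr⟩)
    (fun h h' => Subtype.ext (Sum.inl.inj (h1.sim.func h h')))
    (fun h h' => Subtype.ext (Sum.inl.inj (f2 h h')))
  obtain ⟨μ, hμ⟩ := exists_equiv_of_rel (r := ε) h1.edge h2.edge h1.edge_func h2.edge_func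
  exact ⟨⟨η, μ, ν, h1.n_eq, fun e => h1.rank_eq (hμ e),
      fun i => h1.sim.func (hν _) (h1.abs _ _ rfl), fun v => h1.sim.func (hν _) (hη v),
      fun e i => h1.sim.func (hν _) (h1.att (hμ e) _ _ rfl)⟩,
    fun x => h1.sim.word (hν x),
    fun x y => ⟨h1.sim.fin (hν x) (hν y), fun w hw => by
      obtain ⟨w', hw', he⟩ := h2.sim.fin (hν x) (hν y) w hw
      exact ⟨w', hw', BuchiAutomaton.WordEquiv.symm M he⟩⟩,
    fun x => ⟨h1.sim.inf (hν x), fun w hw => by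
      obtain ⟨w', hw', he⟩ := h2.sim.inf (hν x) w hw
      exact ⟨w', hw', BuchiAutomaton.OmegaEquiv.symm M he⟩⟩⟩

theorem HalfEquiv.of_mequivVia {κ : HGV.Coupling 𝓥 𝓥'} (hκ : M.MEquivVia κ) :
    HalfEquiv M 𝓥 𝓥' (fun x x' => ∃ hx, (κ.ν ⟨x, hx⟩).1 = x') (fun e e' => κ.μ e = e') := by
  obtain ⟨h1, h2, h3⟩ := hκ
  refine ⟨⟨?_, ?_, ?_, ?_, ?_⟩, κ.n_eq, ?_, ?_, fun e => ⟨_, rfl⟩, fun h h' => h.symm.trans h', ?_,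
    ?_⟩
  · rintro x y z ⟨_, rfl⟩ ⟨_, rfl⟩
    rfl
  · rintro x y ⟨hx, rfl⟩
    rcases x with v | i
    · rcases hy : (κ.ν ⟨Sum.inl v, hx⟩).1 with v' | j
      · rfl
      -- Every abstract node is already the image of an abstract node, so injectivity of `ν` forbids
      -- a concrete preimage.
      · have h := κ.ν_abs (Fin.cast κ.n_eq.symm j)
        have := κ.ν.injective (Subtype.ext (h.trans hy.symm))
        exact absurd (congrArg Subtype.val this) Sum.inr_ne_inl
    · rw [κ.ν_abs]
      rfl
  · rintro x y ⟨hx, rfl⟩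
    exact h1 ⟨x, hx⟩
  · rintro x x' y y' ⟨hx, rfl⟩ ⟨hy, rfl⟩
    exact (h2 ⟨x, hx⟩ ⟨y, hy⟩).1
  · rintro x x' ⟨hx, rfl⟩
    exact (h3 ⟨x, hx⟩).1
  · intro i i' h
    exact ⟨𝓥.abs_mem_X i, (κ.ν_abs i).trans (congrArg Sum.inr (Fin.ext h))⟩
  · intro v hv
    exact ⟨_, (κ.η ⟨v, hv⟩).2, 𝓥.view_mem_X ⟨v, hv⟩, κ.ν_view ⟨v, hv⟩⟩
  · rintro e e' rfl
    exact κ.rank_eq e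
  · rintro e e' rfl i i' h
    exact ⟨𝓥.att_mem_X e i, (κ.ν_att e i).trans (HGV.Coupling.att_congr 𝓥' rfl _ _ h)⟩

theorem RelEquiv.of_mequivVia {κ : HGV.Coupling 𝓥 𝓥'} (hκ : M.MEquivVia κ) :
    RelEquiv M 𝓥 𝓥' (fun x x' => ∃ hx, (κ.ν ⟨x, hx⟩).1 = x') (fun e e' => κ.μ e = e') := by
  refine ⟨HalfEquiv.of_mequivVia hκ, ?_⟩
  have hs : M.MEquivVia κ.symm := by
    obtain ⟨h1, h2, h3⟩ := hκ
    have key : ∀ x, κ.ν (κ.symm.ν x) = x := fun x => κ.ν.apply_symm_apply x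
    refine ⟨fun x => ?_, fun x y => ?_, fun x => ?_⟩
    · have := h1 (κ.symm.ν x)
      rw [key] at this
      exact BuchiAutomaton.WordEquiv.symm M this
    · have := h2 (κ.symm.ν x) (κ.symm.ν y)
      rw [key, key] at this
      exact this.symm fun _ _ => BuchiAutomaton.WordEquiv.symm M
    · have := h3 (κ.symm.ν x)
      rw [key] at this
      exact this.symm fun _ _ => BuchiAutomaton.OmegaEquiv.symm M
  have := HalfEquiv.of_mequivVia hs
  convert this using 1
  · funext x' x
    refine propext ⟨?_, ?_⟩
    · rintro ⟨hx, rfl⟩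
      exact ⟨(κ.ν ⟨x, hx⟩).2, congrArg Subtype.val (κ.ν.symm_apply_apply ⟨x, hx⟩)⟩
    · rintro ⟨hx', rfl⟩
      exact ⟨(κ.symm.ν ⟨x', hx'⟩).2, congrArg Subtype.val (κ.ν.apply_symm_apply ⟨x', hx'⟩)⟩
  · funext e' e
    exact propext (κ.μ.symm_apply_eq.trans eq_comm).symm

/-- Relations compose well with replacement: nodes that are attached before but not after it may
stay related, and restricting to exposed nodes is postponed to the end. -/
theorem exists_relEquiv_iff : M.MEquiv 𝓥 𝓥' ↔ ∃ ρ ε, RelEquiv M 𝓥 𝓥' ρ ε :=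
  ⟨fun ⟨_, h⟩ => ⟨_, _, RelEquiv.of_mequivVia h⟩, fun ⟨_, _, h⟩ => h.mequiv⟩

/-! ### `M`-equivalence is a congruence -/

variable {K : 𝓥.H.E → HGV C Act L} {K' : 𝓥'.H.E → HGV C Act L}
  {hK : ∀ e, (K e).H.n = 𝓥.H.rank e} {hK' : ∀ e, (K' e).H.n = 𝓥'.H.rank e}
  {ρ : 𝓥.H.W → 𝓥'.H.W → Prop} {ε : 𝓥.H.E → 𝓥'.H.E → Prop}
  {σ : ∀ e e', (K e).H.W → (K' e').H.W → Prop} {τ : ∀ e e', (K e).H.E → (K' e').H.E → Prop}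

variable (hK hK') in
theorem HalfEquiv.replSim (h : HalfEquiv M 𝓥 𝓥' ρ ε)
    (hi : ∀ {e e'}, ε e e' → HalfEquiv M (K e) (K' e') (σ e e') (τ e e')) :
    ReplSim M 𝓥.H 𝓥'.H (fun e => (K e).H) (fun e => (K' e).H) hK hK' ρ ε σ where
  sim := h.sim
  edge := h.edge
  edge_func := h.edge_func
  n_eq he := (hi he).n_eq
  att he _ _ hii := h.att he _ _ hii
  inner he := (hi he).sim
  abs he := (hi he).abs

theorem LiftRel.inner {H H' : HG C Act L} {K : H.E → HG C Act L}
    {K' : H'.E → HG C Act L} {hK : ∀ e, (K e).n = H.rank e} {hK' : ∀ e, (K' e).n = H'.rank e}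
    {ρ : H.W → H'.W → Prop} {ε : H.E → H'.E → Prop} {σ : ∀ e e', (K e).W → (K' e').W → Prop}
    (S : ReplSim M H H' K K' hK hK' ρ ε σ) {e e'} (he : ε e e') {x x'} (h : σ e e' x x') :
    LiftRel hK hK' ρ ε σ (innerNode hK e x) (innerNode hK' e' x') := by
  rcases x with v | i
  · have hc := (S.inner he).conc h
    obtain ⟨v', rfl⟩ := Sum.isLeft_iff.1 hc.symm
    exact Or.inr ⟨e, e', v, v', he, h, rfl, rfl⟩
  · obtain rfl := (S.inner he).func (S.abs he i (Fin.cast (S.n_eq he) i) rfl) h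
    exact LiftRel.outer (S.att he _ _ rfl)

theorem flip_liftRel {H H' : HG C Act L} {K : H.E → HG C Act L}
    {K' : H'.E → HG C Act L} {hK : ∀ e, (K e).n = H.rank e} {hK' : ∀ e, (K' e).n = H'.rank e}
    {ρ : H.W → H'.W → Prop} {ε : H.E → H'.E → Prop} {σ : ∀ e e', (K e).W → (K' e').W → Prop} :
    flip (LiftRel hK hK' ρ ε σ) =
      LiftRel hK' hK (flip ρ) (flip ε) fun e' e => flip (σ e e') := by
  funext x' x
  refine propext ⟨?_, ?_⟩
  · rintro (⟨a, b, h, rfl, rfl⟩ | ⟨e, e', v, v', h1, h2, rfl, rfl⟩)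
    · exact Or.inl ⟨b, a, h, rfl, rfl⟩
    · exact Or.inr ⟨e', e, v', v, h1, h2, rfl, rfl⟩
  · rintro (⟨a, b, h, rfl, rfl⟩ | ⟨e, e', v, v', h1, h2, rfl, rfl⟩)
    · exact Or.inl ⟨b, a, h, rfl, rfl⟩
    · exact Or.inr ⟨e', e, v', v, h1, h2, rfl, rfl⟩

theorem HalfEquiv.repl [Finite Q] (h : HalfEquiv M 𝓥 𝓥' ρ ε)
    (hi : ∀ {e e'}, ε e e' → HalfEquiv M (K e) (K' e') (σ e e') (τ e e')) :
    HalfEquiv M (𝓥.repl K hK) (𝓥'.repl K' hK') (LiftRel hK hK' ρ ε σ)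
      (fun d d' => ε d.1 d'.1 ∧ τ d.1 d'.1 d.2 d'.2) := by
  have S := h.replSim hK hK' hi
  refine ⟨S.halfSim, h.n_eq, ?_, ?_, ?_, ?_, ?_, ?_⟩
  · intro i i' hii
    exact LiftRel.outer (h.abs i i' hii)
  · rintro x (⟨v, hv, rfl⟩ | ⟨e, v, hv, rfl⟩)
    · obtain ⟨v', hv', hr⟩ := h.view v hv
      exact ⟨_, Or.inl ⟨v', hv', rfl⟩, LiftRel.outer hr⟩
    · obtain ⟨e', he⟩ := h.edge e
      obtain ⟨v', hv', hr⟩ := (hi he).view v hv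
      exact ⟨_, Or.inr ⟨e', v', hv', rfl⟩, LiftRel.inner S he hr⟩
  · rintro ⟨e, d⟩
    obtain ⟨e', he⟩ := h.edge e
    obtain ⟨d', hd⟩ := (hi he).edge d
    exact ⟨⟨e', d'⟩, he, hd⟩
  · rintro ⟨e, d⟩ ⟨e', d'⟩ ⟨e'', d''⟩ ⟨he, hd⟩ ⟨he', hd'⟩
    obtain rfl := h.edge_func he he'
    obtain rfl := (hi he).edge_func hd hd'
    rfl
  · rintro ⟨e, d⟩ ⟨e', d'⟩ ⟨he, hd⟩
    exact (hi he).rank_eq hd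
  · rintro ⟨e, d⟩ ⟨e', d'⟩ ⟨he, hd⟩ i i' hii
    exact LiftRel.inner S he ((hi he).att hd i i' hii)

theorem RelEquiv.repl [Finite Q] (h : RelEquiv M 𝓥 𝓥' ρ ε)
    (hi : ∀ {e e'}, ε e e' → RelEquiv M (K e) (K' e') (σ e e') (τ e e')) :
    RelEquiv M (𝓥.repl K hK) (𝓥'.repl K' hK') (LiftRel hK hK' ρ ε σ)
      (fun d d' => ε d.1 d'.1 ∧ τ d.1 d'.1 d.2 d'.2) := by
  refine ⟨h.1.repl fun he => (hi he).1, ?_⟩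
  have := h.2.repl (hK := hK') (hK' := hK) (σ := fun e' e => flip (σ e e'))
    (τ := fun e' e => flip (τ e e')) fun he => (hi he).2
  rw [← flip_liftRel] at this
  exact this

theorem RelEquiv.sat_iff {x : 𝓥.H.W} {x' : 𝓥'.H.W} (h : RelEquiv M 𝓥 𝓥' ρ ε) (hx : ρ x x') :
    HG.Sat M 𝓥.H x ↔ HG.Sat M 𝓥'.H x' := by
  constructor
  · intro hs w hw
    obtain ⟨w', hw', he⟩ := h.2.sim.inf hx w hw
    obtain ⟨q, hq, ha⟩ := hs hw'
    exact ⟨q, hq, (he q).2 ha⟩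
  · intro hs w hw
    obtain ⟨w', hw', he⟩ := h.1.sim.inf hx w hw
    obtain ⟨q, hq, ha⟩ := hs hw'
    exact ⟨q, hq, (he q).2 ha⟩

/-- Replacement by equivalent views gives equivalent views. -/
theorem exists_relEquiv_repl [Finite Q] (h : RelEquiv M 𝓥 𝓥' ρ ε)
    (hi : ∀ {e e'}, ε e e' → M.MEquiv (K e) (K' e')) (hK : ∀ e, (K e).H.n = 𝓥.H.rank e)
    (hK' : ∀ e, (K' e).H.n = 𝓥'.H.rank e) :
    ∃ (σ : ∀ e e', (K e).H.W → (K' e').H.W → Prop) (δ : _ → _ → Prop),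
      RelEquiv M (𝓥.repl K hK) (𝓥'.repl K' hK') (LiftRel hK hK' ρ ε σ) δ := by
  have : ∀ e e', ∃ σ τ, ε e e' → RelEquiv M (K e) (K' e') σ τ := by
    intro e e'
    by_cases he : ε e e'
    · obtain ⟨σ, τ, hr⟩ := exists_relEquiv_iff.1 (hi he)
      exact ⟨σ, τ, fun _ => hr⟩
    -- Arbitrary values for unrelated pairs of hyperedges.
    · exact ⟨fun _ _ => True, fun _ _ => True, fun h => absurd h he⟩
  choose σ τ hr using this
  exact ⟨σ, _, h.repl fun he => hr _ _ he⟩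

end

universe uL' uL''

/-! ### Isomorphisms that ignore actions and hyperedges -/

/-- A bijection of concrete nodes that preserves edges (up to actions) and colors. -/
structure StepIso {C : Type uC} {Act : Type uA} {L : Type uL} {L' : Type uL'}
    (H : HG C Act L) (H' : HG C Act L') where
  onV : H.V ≃ H'.V
  n_eq : H.n = H'.n
  step_iff : ∀ x y, H.Step x y ↔
    H'.Step (Equiv.sumCongr onV (finCongr n_eq) x) (Equiv.sumCongr onV (finCongr n_eq) y)
  color_eq : ∀ v, H.color v = H'.color (onV v)

namespace StepIso

open HG

variable {C : Type uC} {Act : Type uA} {L : Type uL} {L' : Type uL'} {L'' : Type uL''}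

def onW {H : HG C Act L} {H' : HG C Act L'} (φ : StepIso H H') : H.W ≃ H'.W :=
  Equiv.sumCongr φ.onV (finCongr φ.n_eq)

def trans {H : HG C Act L} {H' : HG C Act L'} {H'' : HG C Act L''} (φ : StepIso H H')
    (ψ : StepIso H' H'') : StepIso H H'' where
  onV := φ.onV.trans ψ.onV
  n_eq := φ.n_eq.trans ψ.n_eq
  step_iff x y := by
    rw [φ.step_iff, ψ.step_iff]
    cases x <;> cases y <;> rfl
  color_eq v := (φ.color_eq v).trans (ψ.color_eq _)

def ofIso {H H' : HG C Act L} (ι : HG.Iso H H') : StepIso H H' where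
  onV := ι.onV
  n_eq := ι.n_eq
  step_iff x y := by
    simp only [Step, ι.edge_iff]
    cases x <;> cases y <;> rfl
  color_eq := ι.color_eq

theorem infTraces_eq {H : HG C Act L} {H' : HG C Act L'} (φ : StepIso H H') (v : H.V) :
    H.infTraces (Sum.inl v) = H'.infTraces (Sum.inl (φ.onV v)) := by
  have e : ∀ u, H'.color u = H.color (φ.onV.symm u) := fun u => by
    rw [φ.color_eq, Equiv.apply_symm_apply]
  ext w
  constructor
  · rintro ⟨p, h0, hs, rfl⟩
    refine ⟨fun i => φ.onV (p i), (φ.step_iff _ _).1 h0, fun i => (φ.step_iff _ _).1 (hs i), ?_⟩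
    simp only [nodeWord, φ.color_eq]
  · rintro ⟨p, h0, hs, rfl⟩
    refine ⟨fun i => φ.onV.symm (p i), (φ.step_iff _ _).2 ?_, fun i => (φ.step_iff _ _).2 ?_, ?_⟩
    · simpa using h0
    · simpa using hs i
    · simp only [nodeWord, φ.color_eq, Equiv.apply_symm_apply]

theorem sat_iff {Q : Type uQ} {M : BuchiAutomaton Q (Set C)} {H : HG C Act L} {H' : HG C Act L'}
    (φ : StepIso H H') (v : H.V) :
    HG.Sat M H (Sum.inl v) ↔ HG.Sat M H' (Sum.inl (φ.onV v)) := by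
  rw [HG.Sat, HG.Sat, φ.infTraces_eq]

/-- Isomorphic replacements of the hyperedges give isomorphic hypergraphs. -/
def replCongr (H : HG C Act L) {K K' : H.E → HG C Act L} (hK : ∀ e, (K e).n = H.rank e)
    (hK' : ∀ e, (K' e).n = H.rank e) (φ : ∀ e, StepIso (K e) (K' e)) :
    StepIso (H.repl K hK) (H.repl K' hK') where
  onV := Equiv.sumCongr (Equiv.refl _) (Equiv.sigmaCongrRight fun e => (φ e).onV)
  n_eq := rfl
  step_iff x y := by
    set F : (H.repl K hK).W ≃ (H.repl K' hK').W := Equiv.sumCongr (Equiv.sumCongr (Equiv.refl _)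
      (Equiv.sigmaCongrRight fun e => (φ e).onV)) (finCongr rfl) with hF
    have ho : ∀ x, F (outerNode hK x) = outerNode hK' x := by
      rintro (v | i) <;> rfl
    have hi : ∀ e x, F (innerNode hK e x) = innerNode hK' e ((φ e).onW x) := by
      rintro e (v | i)
      · rfl
      · exact ho _
    change _ ↔ (H.repl K' hK').Step (F x) (F y)
    rw [repl_step_iff, repl_step_iff]
    constructor
    · rintro (⟨a, b, h, rfl, rfl⟩ | ⟨e, a, b, h, rfl, rfl⟩)
      · exact Or.inl ⟨a, b, h, ho a, ho b⟩
      · exact Or.inr ⟨e, _, _, ((φ e).step_iff a b).1 h, hi e a, hi e b⟩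
    · rintro (⟨a, b, h, h1, h2⟩ | ⟨e, a, b, h, h1, h2⟩)
      · rw [← ho] at h1 h2
        exact Or.inl ⟨a, b, h, F.injective h1, F.injective h2⟩
      · obtain ⟨a, rfl⟩ := (φ e).onW.surjective a
        obtain ⟨b, rfl⟩ := (φ e).onW.surjective b
        rw [← hi] at h1 h2
        exact Or.inr ⟨e, a, b, ((φ e).step_iff a b).2 h, F.injective h1, F.injective h2⟩
  color_eq v := by
    rcases v with v | ⟨e, v⟩
    · rfl
    · exact (φ e).color_eq v

/-- The bijection of concrete nodes underlying the associativity of replacement. -/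
def assocEquiv (H : HG C Act L) (K : H.E → HG C Act L) (hK : ∀ e, (K e).n = H.rank e)
    (B : (H.repl K hK).E → HG C Act L) :
    (H.repl K hK).V ⊕ (Σ d, (B d).V) ≃ H.V ⊕ Σ e, (K e).V ⊕ Σ d, (B ⟨e, d⟩).V where
  toFun
    | Sum.inl (Sum.inl v) => Sum.inl v
    | Sum.inl (Sum.inr ⟨e, v⟩) => Sum.inr ⟨e, Sum.inl v⟩
    | Sum.inr ⟨⟨e, d⟩, v⟩ => Sum.inr ⟨e, Sum.inr ⟨d, v⟩⟩
  invFun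
    | Sum.inl v => Sum.inl (Sum.inl v)
    | Sum.inr ⟨e, Sum.inl v⟩ => Sum.inl (Sum.inr ⟨e, v⟩)
    | Sum.inr ⟨e, Sum.inr ⟨d, v⟩⟩ => Sum.inr ⟨⟨e, d⟩, v⟩
  left_inv := by rintro ((v | ⟨e, v⟩) | ⟨⟨e, d⟩, v⟩) <;> rfl
  right_inv := by rintro (v | ⟨e, v | ⟨d, v⟩⟩) <;> rfl

/-- Hyperedge replacement is associative. -/
def replAssoc (H : HG C Act L) (K : H.E → HG C Act L) (hK : ∀ e, (K e).n = H.rank e)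
    (B : (H.repl K hK).E → HG C Act L) (hB : ∀ d, (B d).n = (H.repl K hK).rank d) :
    StepIso ((H.repl K hK).repl B hB)
      (H.repl (fun e => (K e).repl (fun d => B ⟨e, d⟩) fun d => hB ⟨e, d⟩) hK) where
  onV := assocEquiv H K hK B
  n_eq := rfl
  step_iff x y := by
    let B' : ∀ e, (K e).E → HG C Act L := fun e d => B ⟨e, d⟩
    have hB' : ∀ e d, (B' e d).n = (K e).rank d := fun e d => hB ⟨e, d⟩
    let K' : H.E → HG C Act L := fun e => (K e).repl (B' e) (hB' e)
    have hK' : ∀ e, (K' e).n = H.rank e := hK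
    let F : ((H.repl K hK).repl B hB).W ≃ (H.repl K' hK').W :=
      Equiv.sumCongr (assocEquiv H K hK B) (finCongr rfl)
    have hoo : ∀ x, F (outerNode hB (outerNode hK x)) = outerNode hK' x := by
      rintro (v | i) <;> rfl
    have hoi : ∀ e x, F (outerNode hB (innerNode hK e x)) =
        innerNode hK' e (outerNode (hB' e) x) := by
      rintro e (v | i)
      · rfl
      · exact hoo _
    have hi : ∀ e d x, F (innerNode hB ⟨e, d⟩ x) = innerNode hK' e (innerNode (hB' e) d x) := by
      rintro e d (v | i)
      · rfl
      · exact hoi e _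
    change _ ↔ (H.repl K' hK').Step (F x) (F y)
    rw [repl_step_iff hB, repl_step_iff hK']
    constructor
    · rintro (⟨a, b, h, rfl, rfl⟩ | ⟨⟨e, d⟩, a, b, h, rfl, rfl⟩)
      · rcases (repl_step_iff hK).1 h with ⟨a, b, hs, rfl, rfl⟩ | ⟨e, a, b, hs, rfl, rfl⟩
        · exact Or.inl ⟨a, b, hs, hoo a, hoo b⟩
        · exact Or.inr ⟨e, _, _, (repl_step_iff (hB' e)).2 (Or.inl ⟨a, b, hs, rfl, rfl⟩),
            hoi e a, hoi e b⟩
      · exact Or.inr ⟨e, _, _, (repl_step_iff (hB' e)).2 (Or.inr ⟨d, a, b, h, rfl, rfl⟩),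
          hi e d a, hi e d b⟩
    · rintro (⟨a, b, h, h1, h2⟩ | ⟨e, a, b, h, h1, h2⟩)
      · rw [← hoo] at h1 h2
        exact Or.inl ⟨_, _, (repl_step_iff hK).2 (Or.inl ⟨a, b, h, rfl, rfl⟩), F.injective h1,
          F.injective h2⟩
      · rcases (repl_step_iff (hB' e)).1 h with ⟨a, b, hs, rfl, rfl⟩ | ⟨d, a, b, hs, rfl, rfl⟩
        · rw [← hoi] at h1 h2
          exact Or.inl ⟨_, _, (repl_step_iff hK).2 (Or.inr ⟨e, a, b, hs, rfl, rfl⟩),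
            F.injective h1, F.injective h2⟩
        · rw [← hi] at h1 h2
          exact Or.inr ⟨⟨e, d⟩, a, b, hs, F.injective h1, F.injective h2⟩
  color_eq v := by
    rcases v with (v | ⟨e, v⟩) | ⟨⟨e, d⟩, v⟩ <;> rfl

/-- A hypergraph without hyperedges is not changed by replacement. -/
def replOfIsEmpty (H : HG C Act L) [IsEmpty H.E] (K : H.E → HG C Act L)
    (hK : ∀ e, (K e).n = H.rank e) : StepIso (H.repl K hK) H where
  onV := Equiv.sumEmpty _ _
  n_eq := rfl
  step_iff x y := by
    set F : (H.repl K hK).W ≃ H.W := Equiv.sumCongr (Equiv.sumEmpty _ _) (finCongr rfl) with hF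
    have ho : ∀ x, F (outerNode hK x) = x := by
      rintro (v | i) <;> rfl
    change _ ↔ H.Step (F x) (F y)
    rw [repl_step_iff]
    constructor
    · rintro (⟨a, b, h, rfl, rfl⟩ | ⟨e, -⟩)
      · rwa [ho, ho]
      · exact (IsEmpty.false e).elim
    · intro h
      exact Or.inl ⟨_, _, h, F.injective (ho _).symm, F.injective (ho _).symm⟩
  color_eq v := by
    rcases v with v | ⟨e, v⟩
    · rfl
    · exact (IsEmpty.false e).elim

/-- The bijection of concrete nodes underlying `handleRepl`. -/
def handleEquiv (α : Type) : Empty ⊕ (Σ _ : Unit, α) ≃ α where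
  toFun
    | Sum.inl v => v.elim
    | Sum.inr ⟨_, v⟩ => v
  invFun v := Sum.inr ⟨(), v⟩
  left_inv := by
    rintro (v | ⟨_, v⟩)
    · exact v.elim
    · rfl
  right_inv _ := rfl

/-- Replacing the hyperedge of a handle by `X` gives `X`. -/
def handleRepl (A : L) (k : ℕ) (X : HG C Act L)
    (hX : ∀ e, X.n = (HG.handle (C := C) (Act := Act) A k).rank e) :
    StepIso ((HG.handle A k).repl (fun _ => X) hX) X where
  onV := handleEquiv X.V
  n_eq := (hX ()).symm
  step_iff x y := by
    let F : ((HG.handle A k).repl (fun _ => X) hX).W ≃ X.W :=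
      Equiv.sumCongr (handleEquiv X.V) (finCongr (hX ()).symm)
    have hi : ∀ x, F (innerNode hX () x) = x := by
      rintro (v | i) <;> rfl
    change _ ↔ X.Step (F x) (F y)
    rw [repl_step_iff]
    constructor
    · rintro (⟨a, b, ⟨_, h⟩, -⟩ | ⟨⟨⟩, a, b, h, rfl, rfl⟩)
      · exact h.elim
      · rwa [hi, hi]
    · intro h
      exact Or.inr ⟨(), _, _, h, F.injective (hi _).symm, F.injective (hi _).symm⟩
  color_eq v := by
    rcases v with v | ⟨e, v⟩
    · exact v.elim
    · rfl

/-- A hypergraph is recovered by filling a hole at the hyperedge `e` with `K e`. -/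
theorem exists_fillHole (J : HG C Act L) (j : J.E) (R : HG C Act L) (e : R.E)
    {K K₁ : R.E → HG C Act L} (hK : ∀ e, (K e).n = R.rank e) (hK₁ : ∀ e, (K₁ e).n = R.rank e)
    (hE : ∀ e, IsEmpty (K e).E) {A : L} {k : ℕ} (h1 : K₁ e = HG.handle A k)
    (h2 : ∀ e', e' ≠ e → K₁ e' = K e') (hJ : ∀ j, R.n = J.rank j) (d : (K₁ e).E)
    (hd : ∀ d, (K e).n = (J.repl (fun _ => R.repl K₁ hK₁) hJ).rank d) :
    ∃ φ : StepIso ((J.repl (fun _ => R.repl K₁ hK₁) hJ).repl (fun _ => K e) hd)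
        (J.repl (fun _ => R.repl K hK) hJ),
      ∀ v, φ.onV (Sum.inr ⟨⟨j, ⟨e, d⟩⟩, v⟩) = Sum.inr ⟨j, Sum.inr ⟨e, v⟩⟩ := by
  -- Filling with `K e` turns the handle at `e` into `K e` and leaves the other parts alone, as they
  -- have no hyperedges. The type of `φ` depends on `e'`, hence the heterogeneous equality.
  have aux : ∀ e' (X : HG C Act L), (e' = e → X = HG.handle A k) → (e' ≠ e → X = K e') →
      ∀ hX : ∀ d, (K e).n = X.rank d, ∃ φ : StepIso (X.repl (fun _ => K e) hX) (K e'),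
        ∀ _ : e' = e, ∀ d (v : (K e).V), HEq (φ.onV (Sum.inr ⟨d, v⟩)) v := by
    intro e' X hX1 hX2 hX
    by_cases he : e' = e
    · subst he
      obtain rfl := hX1 rfl
      exact ⟨handleRepl A k (K e') hX, fun _ _ _ => HEq.rfl⟩
    · obtain rfl := hX2 he
      have := hE e'
      exact ⟨replOfIsEmpty (K e') _ hX, fun h => absurd h he⟩
  have hd' : ∀ e' d, (K e).n = (K₁ e').rank d := fun e' d => hd ⟨j, ⟨e', d⟩⟩
  choose φ hφ using fun e' => aux e' (K₁ e') (fun h => h ▸ h1) (h2 e') (hd' e')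
  -- Associativity moves the filling first into `R[K₁]` and then into each `K₁ e'`, where `φ`
  -- applies.
  refine ⟨((replAssoc J (fun _ => R.repl K₁ hK₁) hJ (fun _ => K e) hd).trans
    (replCongr J (K := fun _ => (R.repl K₁ hK₁).repl (fun _ => K e) fun d => hd' d.1 d.2)
      (K' := fun _ => R.repl (fun e' => (K₁ e').repl (fun _ => K e) (hd' e')) hK₁) hJ hJ
      fun _ => replAssoc R K₁ hK₁ (fun _ => K e) fun d => hd' d.1 d.2)).trans
    (replCongr J (K := fun _ => R.repl (fun e' => (K₁ e').repl (fun _ => K e) (hd' e')) hK₁)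
      (K' := fun _ => R.repl K hK) hJ hJ fun _ =>
      replCongr R (K := fun e' => (K₁ e').repl (fun _ => K e) (hd' e')) hK₁ hK φ), fun v => ?_⟩
  change (Sum.inr ⟨j, Sum.inr ⟨e, (φ e).onV (Sum.inr ⟨d, v⟩)⟩⟩ :
    (J.repl (fun _ => R.repl K hK) hJ).V) = _
  rw [eq_of_heq (hφ e rfl d v)]

end StepIso

/-! ### Erasing the new color and the classes in labels -/

namespace HG

variable {C : Type uC} {Act : Type uA} {N : Type uL} {T : Type*}

/-- Deletion of the new color and of the second components of all labels. -/
abbrev erase (H : HG (Option C) Act (N × T)) : HG C Act N := H.del.mapLab Prod.fst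

theorem mk_congr {V : Type} {finV : Finite V} {n : ℕ}
    {edge edge' : Set ((V ⊕ Fin n) × Act × (V ⊕ Fin n))} {E : Type} {finE : Finite E}
    {rank : E → ℕ} {att att' : (e : E) → Fin (rank e) → V ⊕ Fin n} {color color' : V → Set C}
    {lab : E → N} (h1 : edge = edge') (h2 : att = att') (h3 : color = color') :
    HG.mk V finV n edge E finE rank att color lab =
      HG.mk V finV n edge' E finE rank att' color' lab := by
  subst h1 h2 h3
  rfl

/-- An equality rather than an isomorphism, so that it can be used inside `M.cls`. -/
theorem erase_repl (H : HG (Option C) Act (N × T)) (K : H.E → HG (Option C) Act (N × T))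
    (hK : ∀ e, (K e).n = H.rank e) :
    (H.repl K hK).erase = H.erase.repl (fun e => (K e).erase) hK := by
  have ho : ∀ x, H.outer K x = H.erase.outer (fun e => (K e).erase) x := by
    rintro (v | i) <;> rfl
  have hi : ∀ e x, H.inner K hK e x = H.erase.inner (fun e => (K e).erase) hK e x := by
    rintro e (v | i)
    · rfl
    · exact ho _
  refine mk_congr ?_ ?_ ?_
  · ext t
    constructor
    · rintro (⟨x, a, y, h, rfl⟩ | ⟨e, x, a, y, h, rfl⟩)
      · exact Or.inl ⟨x, a, y, h, congrArg₂ (fun x y => (x, a, y)) (ho x) (ho y)⟩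
      · exact Or.inr ⟨e, x, a, y, h, congrArg₂ (fun x y => (x, a, y)) (hi e x) (hi e y)⟩
    · rintro (⟨x, a, y, h, rfl⟩ | ⟨e, x, a, y, h, rfl⟩)
      · exact Or.inl ⟨x, a, y, h, congrArg₂ (fun x y => (x, a, y)) (ho x).symm (ho y).symm⟩
      · exact Or.inr ⟨e, x, a, y, h,
          congrArg₂ (fun x y => (x, a, y)) (hi e x).symm (hi e y).symm⟩
  · funext d i
    exact hi d.1 _
  · funext v
    rcases v with v | v <;> rfl

theorem sat_repl_congr {L : Type*} {Q : Type*} {M : BuchiAutomaton Q (Set C)} (J : HG C Act L)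
    {X Y : HG C Act L} (h : X = Y) (hX : ∀ j, X.n = J.rank j) (hY : ∀ j, Y.n = J.rank j) (j : J.E)
    (v : X.V) (u : Y.V) (hvu : HEq v u) :
    Sat M (J.repl (fun _ => X) hX) (Sum.inl (Sum.inr ⟨j, v⟩)) ↔
      Sat M (J.repl (fun _ => Y) hY) (Sum.inl (Sum.inr ⟨j, u⟩)) := by
  subst h
  obtain rfl := eq_of_heq hvu
  rfl

def delErase (H : HG (Option C) Act (N × T)) : StepIso H.del H.erase where
  onV := Equiv.refl _
  n_eq := rfl
  step_iff x y := by cases x <;> cases y <;> rfl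
  color_eq _ := rfl

def Iso.del {L : Type*} {H H' : HG (Option C) Act L} (ι : Iso H H') : Iso H.del H'.del where
  onV := ι.onV
  onE := ι.onE
  n_eq := ι.n_eq
  edge_iff := ι.edge_iff
  rank_eq := ι.rank_eq
  att_eq := ι.att_eq
  color_eq v := congrArg (fun s => {c | some c ∈ s}) (ι.color_eq v)
  lab_eq := ι.lab_eq

end HG

theorem HGV.trivial_repl {C : Type uC} {Act : Type uA} {L : Type uL} (H : HG C Act L)
    (K : H.E → HG C Act L) (hK : ∀ e, (K e).n = H.rank e) :
    HGV.trivial (H.repl K hK) = (HGV.trivial H).repl (fun e => HGV.trivial (K e)) hK := by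
  have h : ((HGV.trivial H).repl (fun e => HGV.trivial (K e)) hK).U = ∅ := by
    refine Set.eq_empty_of_forall_notMem ?_
    rintro x (⟨v, hv, -⟩ | ⟨e, v, hv, -⟩)
    · exact hv
    · exact hv
  change HGV.mk _ _ _ = HGV.mk _ ((HGV.trivial H).repl (fun e => HGV.trivial (K e)) hK).U _
  congr 1
  exact h.symm

/-! ### Independence of representatives and contexts of hyperedges -/

section

variable {Q : Type uQ} {C : Type uC} {Act : Type uA} {L : Type uL}
  {M : BuchiAutomaton Q (Set C)}

theorem mequiv_repl_of_forall [Finite Q] (𝓥 : HGV C Act L) {K K' : 𝓥.H.E → HGV C Act L}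
    (hK : ∀ e, (K e).H.n = 𝓥.H.rank e) (hK' : ∀ e, (K' e).H.n = 𝓥.H.rank e)
    (h : ∀ e, M.MEquiv (K e) (K' e)) : M.MEquiv (𝓥.repl K hK) (𝓥.repl K' hK') := by
  obtain ⟨σ, δ, hr⟩ := exists_relEquiv_repl (RelEquiv.refl (M := M) 𝓥) (K := K) (K' := K')
    (fun {e e'} he => he ▸ h e) hK hK'
  exact hr.mequiv

theorem mequiv_plug [Finite Q] {J J' B B' : HGV C Act L} (hJ : M.MEquiv J J')
    (hB : M.MEquiv B B') (h : ∀ e, B.H.n = J.H.rank e) (h' : ∀ e, B'.H.n = J'.H.rank e) :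
    M.MEquiv (J.repl (fun _ => B) h) (J'.repl (fun _ => B') h') := by
  obtain ⟨ρ, ε, hr⟩ := exists_relEquiv_iff.1 hJ
  obtain ⟨σ, δ, hr⟩ := exists_relEquiv_repl hr (K := fun _ => B) (K' := fun _ => B')
    (fun _ => hB) h h'
  exact hr.mequiv

/-- Whether a node of `R` satisfies `M` in `J[R[K]]` only depends on the classes of `J` and `K`. -/
theorem sat_congr [Finite Q] {J J' : HGV C Act L} (hJJ : M.MEquiv J J') (R : HGV C Act L)
    {K K' : R.H.E → HGV C Act L} (hKK : ∀ e, M.MEquiv (K e) (K' e))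
    (hK : ∀ e, (K e).H.n = R.H.rank e) (hK' : ∀ e, (K' e).H.n = R.H.rank e)
    (hJ : ∀ j, R.H.n = J.H.rank j) (hJ' : ∀ j, R.H.n = J'.H.rank j) (j : J.H.E) (j' : J'.H.E)
    (hj' : ∀ i, i = j') (v : R.H.V) :
    HG.Sat M (J.H.repl (fun _ => R.H.repl (fun e => (K e).H) hK) hJ)
        (Sum.inl (Sum.inr ⟨j, Sum.inl v⟩)) ↔
      HG.Sat M (J'.H.repl (fun _ => R.H.repl (fun e => (K' e).H) hK') hJ')
        (Sum.inl (Sum.inr ⟨j', Sum.inl v⟩)) := by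
  obtain ⟨ρ, ε, hr⟩ := exists_relEquiv_iff.1 hJJ
  -- The identity relates every node of `R` to itself, so `v` keeps a partner even if it is not
  -- exposed after the replacement.
  obtain ⟨σ, δ, hR⟩ := exists_relEquiv_repl (RelEquiv.refl (M := M) R) (K := K) (K' := K')
    (fun {e e'} he => he ▸ hKK e) hK hK'
  have := hr.repl (K := fun _ => R.repl K hK) (K' := fun _ => R.repl K' hK') (hK := hJ)
    (hK' := hJ') (σ := fun _ _ => LiftRel hK hK' Eq Eq σ) (τ := fun _ _ => δ) fun _ => hR
  refine this.sat_iff (Or.inr ⟨j, j', Sum.inl v, Sum.inl v, ?_, ?_, rfl, rfl⟩)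
  -- `j'` is the only hyperedge of `J'`, so it is the partner of `j`.
  · obtain ⟨i, hi⟩ := hr.1.edge j
    rwa [hj' i] at hi
  · exact LiftRel.outer (x := Sum.inl v) rfl

theorem mem_update_congr {ι α : Type*} [DecidableEq ι] {f g : ι → Set α} (h : ∀ i, f i = g i)
    {i j : ι} {c : Set α} {x : α} (hx : x ∈ Function.update f i c j) :
    x ∈ Function.update g i c j := by
  rwa [← funext h]

/-- The context of the hyperedge `e` in `J[R[K]]`: its class only depends on the classes of `J` and
`K`, and filling it with `K e` gives `J[R[K]]`. -/
theorem exists_context [Finite Q] (J : HG C Act L) (j : J.E) (hj : ∀ i, i = j) (R : HG C Act L)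
    [DecidableEq R.E] (e : R.E) {K : R.E → HG C Act L} (hK : ∀ e, (K e).n = R.rank e)
    (hE : ∀ e, IsEmpty (K e).E) {A : L} {k : ℕ} (hk : k = R.rank e) (hJ : ∀ i, R.n = J.rank i)
    (K' : R.E → HGV C Act L) (hK' : ∀ e, (K' e).H.n = R.rank e)
    (hKm : ∀ e', K' e' ∈ Function.update (fun e => M.cls (HGV.trivial (K e))) e
      (M.cls (HGV.trivial (HG.handle A k))) e')
    {J' B : HGV C Act L} (hJ' : J' ∈ M.cls (HGV.trivial J))
    (hB : B ∈ M.cls ((HGV.trivial R).repl K' hK')) (hBn : ∀ i, B.H.n = J'.H.rank i) :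
    ∃ (J₁ : HG C Act L) (j₁ : J₁.E), (∀ i, i = j₁) ∧ ∃ h : ∀ i, (K e).n = J₁.rank i,
      M.cls (J'.repl (fun _ => B) hBn) = M.cls (HGV.trivial J₁) ∧
      ∀ v, HG.Sat M (J₁.repl (fun _ => K e) h) (Sum.inl (Sum.inr ⟨j₁, v⟩)) ↔
        HG.Sat M (J.repl (fun _ => R.repl K hK) hJ) (Sum.inl (Sum.inr ⟨j, Sum.inr ⟨e, v⟩⟩)) := by
  -- The new context is `J[R[K₁]]`; its only hyperedge is the handle at `e`, since the other `K e'`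
  -- have none.
  let K₁ : R.E → HG C Act L := Function.update K e (HG.handle A k)
  have h1 : K₁ e = HG.handle A k := Function.update_self _ _ _
  have h2 : ∀ e', e' ≠ e → K₁ e' = K e' := fun e' he => Function.update_of_ne he _ _
  have hK₁ : ∀ e', (K₁ e').n = R.rank e' := fun e' => by
    by_cases he : e' = e
    · subst he
      rw [h1]
      exact hk
    · rw [h2 e' he, hK]
  obtain ⟨d, hd, hr⟩ : ∃ d : (K₁ e).E, (∀ d', d' = d) ∧ ∀ d', (K₁ e).rank d' = k := by
    rw [h1]
    exact ⟨(), fun _ => rfl, fun _ => rfl⟩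
  have hE₁ : ∀ e', e' ≠ e → IsEmpty (K₁ e').E := fun e' he => by
    rw [h2 e' he]
    exact hE e'
  have hKK : ∀ e', M.MEquiv (K' e') (HGV.trivial (K₁ e')) := fun e' => by
    have := hKm e'
    by_cases he : e' = e
    · subst he
      rw [Function.update_self] at this
      rw [h1]
      exact BuchiAutomaton.MEquiv.symm M this
    · rw [Function.update_of_ne he] at this
      rw [h2 e' he]
      exact BuchiAutomaton.MEquiv.symm M this
  have hrank : ∀ i, (K e).n = (J.repl (fun _ => R.repl K₁ hK₁) hJ).rank i := by
    rintro ⟨i, e', d'⟩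
    change _ = (K₁ e').rank d'
    by_cases he : e' = e
    · subst he
      rw [hr, hK, hk]
    · exact ((hE₁ e' he).false d').elim
  have hB' : M.MEquiv B (HGV.trivial (R.repl K₁ hK₁)) := by
    rw [HGV.trivial_repl]
    exact BuchiAutomaton.MEquiv.trans M (BuchiAutomaton.MEquiv.symm M hB)
      (mequiv_repl_of_forall (HGV.trivial R) (K' := fun e => HGV.trivial (K₁ e)) hK' hK₁ hKK)
  obtain ⟨ψ, hψ⟩ := StepIso.exists_fillHole J j R e hK hK₁ hE h1 h2 hJ d hrank
  refine ⟨J.repl (fun _ => R.repl K₁ hK₁) hJ, ⟨j, e, d⟩, ?_, hrank, M.cls_eq ?_, fun v => ?_⟩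
  · rintro ⟨i, e', d'⟩
    obtain rfl := hj i
    by_cases he : e' = e
    · subst he
      rw [hd d']
    · exact ((hE₁ e' he).false d').elim
  · exact (congrArg (M.MEquiv _) (HGV.trivial_repl J (fun _ => R.repl K₁ hK₁) hJ)).mpr
      (mequiv_plug (BuchiAutomaton.MEquiv.symm M hJ') hB' hBn hJ)
  · rw [← hψ]
    exact ψ.sat_iff _

end

/-! ### Induction on derivation trees -/

namespace HRG

variable {C : Type uC} {Act : Type uA} {N : Type uL} {Q : Type uQ} [Finite Q]
  {G : HRG C Act N} {M : BuchiAutomaton Q (Set C)}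

/-- The second component of a nonterminal is the class of the derived hypergraphs. -/
theorem recolor_cls_sem {t : N × Set (HGV C Act N) × Set (HGV C Act N)}
    (T : Tree (G.recolor M) t) (hT : T.Complete) :
    t.2.1 = M.cls (HGV.trivial T.sem.1.erase) := by
  induction T with
  | leaf A => exact hT.elim
  | @node A R hR sub ih =>
    obtain ⟨K, hK, hKm, hc⟩ := hR.1.2.2.2.1
    have hn : ∀ e, (sub e).sem.1.erase.n = R.erase.rank e := fun e =>
      (sub e).sem.2.trans (((G.recolor M).rules_ok _ hR).2.2 e).2.symm
    have e : (Tree.node R hR sub).sem.1.erase =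
        R.erase.repl (fun e => (sub e).sem.1.erase) hn := HG.erase_repl R _ hn
    refine (hc.trans (M.cls_eq (mequiv_repl_of_forall (HGV.trivial R.erase)
      (K' := fun e => HGV.trivial (sub e).sem.1.erase) hK hn
      fun e => ?_))).trans (congrArg M.cls ((congrArg HGV.trivial e).trans
        (HGV.trivial_repl R.erase _ hn)).symm)
    exact BuchiAutomaton.MEquiv.symm M ((Set.ext_iff.1 (ih e (hT e)) _).1 (hKm e))

/-- The context `J` is an arbitrary representative of the third component: descending into a subtree
replaces it by a larger context, so the induction has to allow all of them. -/
theorem recolor_color_iff {t : N × Set (HGV C Act N) × Set (HGV C Act N)}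
    (T : Tree (G.recolor M) t) (hT : T.Complete) (J : HG C Act N) (j : J.E) (hj : ∀ i, i = j)
    (hJ : ∀ i, T.sem.1.erase.n = J.rank i) (hc : t.2.2 = M.cls (HGV.trivial J))
    (v : T.sem.1.V) :
    none ∈ T.sem.1.color v ↔
      HG.Sat M (J.repl (fun _ => T.sem.1.erase) hJ) (Sum.inl (Sum.inr ⟨j, v⟩)) := by
  classical
  induction T generalizing J with
  | leaf A => exact hT.elim
  | @node A R hR sub ih =>
    have hn : ∀ e, (sub e).sem.1.erase.n = R.erase.rank e := fun e =>
      (sub e).sem.2.trans (((G.recolor M).rules_ok _ hR).2.2 e).2.symm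
    have hJR : ∀ i, R.erase.n = J.rank i := hJ
    refine Iff.trans ?_ (HG.sat_repl_congr J (show (Tree.node R hR sub).sem.1.erase =
      R.erase.repl (fun e => (sub e).sem.1.erase) hn from HG.erase_repl R _ hn) hJ hJR j v v
        HEq.rfl).symm
    have hmem : ∀ e, HGV.trivial (sub e).sem.1.erase ∈ (R.lab e).2.1 := fun e => by
      rw [recolor_cls_sem (sub e) (hT e)]
      exact BuchiAutomaton.MEquiv.refl M _
    rcases v with v | ⟨e, v⟩
    · refine (hR.2 v).trans ⟨?_, fun h => ?_⟩
      -- The rule tests some representatives; `sat_congr` moves the verdict to the actual context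
      -- and the actual subtrees.
      · rintro ⟨J', hJ', u, K, hK, hKn, hJn, h⟩
        have hJJ : M.MEquiv (HGV.trivial J) J' := by rwa [hc] at hJ'
        refine (sat_congr hJJ (HGV.full R.erase)
          (K := fun e => HGV.trivial (sub e).sem.1.erase) (K' := K) (fun e => ?_) hn hKn hJR hJn j
          u.default u.uniq v).2 h
        exact (Set.ext_iff.1 (recolor_cls_sem (sub e) (hT e)) _).1 (hK e)
      · refine ⟨HGV.trivial J, ?_, ⟨⟨j⟩, hj⟩, fun e => HGV.trivial (sub e).sem.1.erase, hmem, hn,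
          hJR, h⟩
        rw [hc]
        exact BuchiAutomaton.MEquiv.refl M _
    -- A node of the subtree at `e` is judged in the context `J₁` of `e`. The rule makes the class
    -- of `J₁` the third component of the label of `e`, and filling `J₁` gives back the same
    -- hypergraph.
    · obtain ⟨𝔅, ⟨K', hK', hKm, rfl⟩, J', hJ', B, hB, -, hBn, hD⟩ := hR.1.2.2.2.2 e
      obtain ⟨J₁, j₁, hj₁, hrank, hcJ, hS⟩ := exists_context J j hj R.erase e hn
        (fun e => Tree.isEmpty_of_complete (sub e) (hT e))
        (((G.recolor M).rules_ok _ hR).2.2 e).2.symm hJR K' hK'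
        (fun e' => mem_update_congr (fun e => recolor_cls_sem (sub e) (hT e)) (hKm e'))
        ((Set.ext_iff.1 hc _).1 hJ') hB hBn
      exact (ih e (hT e) J₁ j₁ hj₁ hrank (hD.trans hcJ) v).trans (hS v)

end HRG

theorem mainTheorem1 {C : Type uC} {Act : Type uA} {N : Type uL} {Q : Type uQ} [Finite Q]
    (G : HRG C Act N) (M : BuchiAutomaton Q (Set C))
    (H : HG (Option C) Act (N × Set (HGV C Act N) × Set (HGV C Act N)))
    (hH : H ∈ (G.recolor M).language) (v : H.V) :
    none ∈ H.color v ↔ HG.Sat M H.del (Sum.inl v) := by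
  obtain ⟨t, ht, T, hT, ⟨ι⟩⟩ := hH
  have hn : T.sem.1.erase.n = G.ar t.1 := T.sem.2
  rw [ι.color_eq]
  -- The third component of a start symbol is the class of its handle, the empty context.
  refine (HRG.recolor_color_iff T hT (HG.handle t.1 (G.ar t.1)) () (fun _ => rfl)
    (fun _ => hn) ht.2.2 _).trans ?_
  refine ((StepIso.handleRepl t.1 (G.ar t.1) T.sem.1.erase fun _ => hn).sat_iff _).trans ?_
  exact (((StepIso.ofIso ι.del).trans (HG.delErase T.sem.1)).sat_iff v).symm
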